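/- Let $n\ge 3$, $a\in[0,1]$, $H_0=-\Delta$ on $\mathbb{R}^n$ and $P=-i\nabla$. Let $\psi:\mathbb{R}\to H^a(\mathbb{R}^n)$ be a global (weak) solution of $$ i\partial_t\psi-H_0\psi=N(x,t,|\psi|)\,\psi, \qquad \sup_{t\in\mathbb{R}}\|\psi(t)\|_{H^a}<\infty, $$ where the complex-valued interaction $N(x,t,|\psi|)$ may depend on $x$, $t$ and the function $|\psi(t)|$, and suppose that $V(x,t):=N(x,t,|\psi(t)|)$ belongs to $L^\infty_tH^a_x(\mathbb{R}^n\times\mathbb{R})$. (A weak solution is continuous in $t$ in the sense of distributions and satisfies $\langle\psi(t),\varphi\rangle-\langle\psi(0),\varphi\rangle=\int_0^t\big(i\langle\Delta\psi(s),\varphi\rangle-i\langle V(\cdot,s)\psi(s),\varphi\rangle\big)\,ds$ for all Schwartz functions $\varphi$ and all $t\in\mathbb{R}$.) Let $\bar F_c:\mathbb{R}\to\mathbb{R}$ be smooth with $\bar F_c(k)=0$ for $k\le 1/2$ and $\bar F_c(k)=1$ for $k\ge 1$, and put $F_c(\lambda\le 1):=1-\bar F_c(\lambda)$ and $\bar F_c(\lambda>1):=\bar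 F_c(\lambda)$. Functions of $x-2tP$ are defined by $g(x-2tP)=e^{-itH_0}g(x)e^{itH_0}$. Then for every $\alpha\in(0,1-2/n)$: 1. The free channel wave operator acting on $\psi(0)$, $$\Omega_\alpha^*\psi(0)=\operatorname*{s-lim}_{t\to\infty}e^{itH_0}F_c\Big(\frac{|x-2tP|}{t^\alpha}\le 1\Big)\psi(t),$$ exists in $H^a(\mathbb{R}^n)$. 2. $\operatorname*{w-lim}_{t\to\infty}e^{itH_0}\bar F_c\Big(\dfrac{|x-2tP|}{t^\alpha}>1\Big)\psi(t)=0$ in $H^a(\mathbb{R}^n)$. 3. With $\psi_w(t):=\bar F_c\Big(\dfrac{|x-2tP|}{t^\alpha}>1\Big)\psi(t)$, $$\lim_{t\to\infty}\big\|\psi(t)-e^{-itH_0}\Omega_\alpha^*\psi(0)-\psi_w(t)\big\|_{H^a}=0.$$ -/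

import Mathlib

open MeasureTheory Filter Topology
open scoped SchwartzMap Laplacian ContDiff ENNReal

noncomputable section

/-! ### The Sobolev space `H^a(ℝⁿ)` as a normed space -/

/-- `ℝⁿ` with its Euclidean norm. -/
abbrev Eucl (n : ℕ) : Type := EuclideanSpace ℝ (Fin n)

/-- The complex vector space of all tempered distributions on `ℝⁿ` of Sobolev class `H^a`. -/
def sobolevSubmodule (n : ℕ) (a : ℝ) : Submodule ℂ 𝓢'(Eucl n, ℂ) where
  carrier := {u | TemperedDistribution.MemSobolev a 2 u}
  add_mem' := fun hu hv => hu.add hv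
  zero_mem' := TemperedDistribution.memSobolev_fun_zero (Eucl n) ℂ a 2
  smul_mem' := fun c _ hu => hu.smul c

/-- The Sobolev space `H^a(ℝⁿ)` of complex-valued distributions. It carries the Sobolev norm
below and not the topology of pointwise convergence of distributions. -/
def SobolevSpace (n : ℕ) (a : ℝ) : Type := sobolevSubmodule n a

namespace SobolevSpace

variable {n : ℕ} {a : ℝ}

instance : AddCommGroup (SobolevSpace n a) :=
  inferInstanceAs (AddCommGroup (sobolevSubmodule n a))

instance : Module ℂ (SobolevSpace n a) :=
  inferInstanceAs (Module ℂ (sobolevSubmodule n a))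

/-- The inclusion of `H^a(ℝⁿ)` into the tempered distributions. -/
def toDistr : SobolevSpace n a →ₗ[ℂ] 𝓢'(Eucl n, ℂ) := (sobolevSubmodule n a).subtype

theorem memSobolev (u : SobolevSpace n a) :
    TemperedDistribution.MemSobolev a 2 (toDistr u) := u.2

theorem toDistr_injective : Function.Injective (toDistr (n := n) (a := a)) :=
  Subtype.val_injective

theorem lp_toTemperedDistribution_injective :
    Function.Injective
      (fun f : Lp ℂ 2 (volume : Measure (Eucl n)) => (f : 𝓢'(Eucl n, ℂ))) :=
  LinearMap.ker_eq_bot.1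
    (Lp.ker_toTemperedDistributionCLM_eq_bot (F := ℂ) (μ := (volume : Measure (Eucl n))) (p := 2))

/-- The `L²` function that represents the Bessel potential of order `a` of `u`. -/
def besselFun (u : SobolevSpace n a) : Lp ℂ 2 (volume : Measure (Eucl n)) :=
  Classical.choose (memSobolev u)

theorem besselFun_spec (u : SobolevSpace n a) :
    TemperedDistribution.besselPotential (Eucl n) ℂ a (toDistr u) =
      Lp.toTemperedDistribution (besselFun u) :=
  Classical.choose_spec (memSobolev u)

/-- The isometry `⟨P⟩^a : H^a → L²`. -/
def bessel : SobolevSpace n a →ₗ[ℂ] Lp ℂ 2 (volume : Measure (Eucl n)) where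
  toFun := besselFun
  map_add' u v := by
    apply lp_toTemperedDistribution_injective
    change Lp.toTemperedDistribution _ = Lp.toTemperedDistribution _
    rw [← besselFun_spec, map_add, map_add, besselFun_spec, besselFun_spec]
    simp only [← Lp.toTemperedDistributionCLM_apply, map_add]
  map_smul' c u := by
    apply lp_toTemperedDistribution_injective
    change Lp.toTemperedDistribution _ = Lp.toTemperedDistribution _
    rw [← besselFun_spec, map_smul, map_smul, besselFun_spec]
    simp only [← Lp.toTemperedDistributionCLM_apply, map_smul, RingHom.id_apply]

theorem bessel_spec (u : SobolevSpace n a) :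
    TemperedDistribution.besselPotential (Eucl n) ℂ a (toDistr u) =
      Lp.toTemperedDistribution (bessel u) :=
  besselFun_spec u

theorem bessel_injective : Function.Injective (bessel (n := n) (a := a)) := by
  intro u v h
  apply toDistr_injective
  have h1 := bessel_spec u
  rw [h, ← bessel_spec v] at h1
  rw [← (TemperedDistribution.besselPotential_neg_apply_eq_iff a _ (toDistr u)).2 rfl,
    ← (TemperedDistribution.besselPotential_neg_apply_eq_iff a _ (toDistr v)).2 rfl, h1]

/-- The Sobolev norm `‖u‖_{H^a} = ‖⟨P⟩^a u‖_{L²}`. -/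
instance : NormedAddCommGroup (SobolevSpace n a) :=
  NormedAddCommGroup.induced _ _ (bessel (n := n) (a := a)) bessel_injective

instance : NormedSpace ℂ (SobolevSpace n a) :=
  NormedSpace.induced ℂ (SobolevSpace n a) (Lp ℂ 2 (volume : Measure (Eucl n))) bessel

theorem exists_toL2 (ha : 0 ≤ a) (u : SobolevSpace n a) :
    ∃ f : Lp ℂ 2 (volume : Measure (Eucl n)), toDistr u = (f : 𝓢'(Eucl n, ℂ)) :=
  TemperedDistribution.memSobolev_zero_iff.1 ((memSobolev u).mono ha)

/-- For `a ≥ 0`: the square integrable function that an element of `H^a(ℝⁿ)` is. -/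
def toL2 (ha : 0 ≤ a) (u : SobolevSpace n a) : Lp ℂ 2 (volume : Measure (Eucl n)) :=
  (exists_toL2 ha u).choose

theorem toL2_spec (ha : 0 ≤ a) (u : SobolevSpace n a) :
    toDistr u = (toL2 ha u : 𝓢'(Eucl n, ℂ)) :=
  (exists_toL2 ha u).choose_spec

/-- `u(t) → v` strongly in `H^a(ℝⁿ)` as `t → ∞`, for a family of distributions which belong to
`H^a(ℝⁿ)` for all `t > 0`. -/
def TendstoStrongly (u : ℝ → 𝓢'(Eucl n, ℂ)) (v : SobolevSpace n a) : Prop :=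
  ∃ w : ℝ → SobolevSpace n a, (∀ t > 0, toDistr (w t) = u t) ∧ Tendsto w atTop (𝓝 v)

/-- `u(t) → v` weakly in `H^a(ℝⁿ)` as `t → ∞`, for a family of distributions which belong to
`H^a(ℝⁿ)` for all `t > 0`. -/
def TendstoWeakly (u : ℝ → 𝓢'(Eucl n, ℂ)) (v : SobolevSpace n a) : Prop :=
  ∃ w : ℝ → SobolevSpace n a, (∀ t > 0, toDistr (w t) = u t) ∧
    ∀ l : StrongDual ℂ (SobolevSpace n a), Tendsto (fun t => l (w t)) atTop (𝓝 (l v))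

end SobolevSpace

/-! ### The free flow and functions of `x - 2tP` -/

/-- The symbol of `e^{-itH₀}`, `H₀ = -Δ`. The Fourier variable `ξ` corresponds to `P = 2πξ`. -/
def freeSymbol (n : ℕ) (t : ℝ) (ξ : Eucl n) : ℂ :=
  Complex.exp (-(Complex.I * ((t * ((2 * Real.pi) ^ 2 * ‖ξ‖ ^ 2) : ℝ) : ℂ)))

theorem freeSymbol_hasTemperateGrowth (n : ℕ) (t : ℝ) :
    (freeSymbol n t).HasTemperateGrowth := by
  have key : (fun r : ℝ => Complex.exp (-(Complex.I * (r : ℂ)))).HasTemperateGrowth := by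
    have hd : ∀ r : ℝ, HasDerivAt (fun r : ℝ => Complex.exp (-(Complex.I * (r : ℂ))))
        (-Complex.I * Complex.exp (-(Complex.I * (r : ℂ)))) r := by
      intro r
      have h1 : HasDerivAt (fun r : ℝ => -(Complex.I * (r : ℂ))) (-Complex.I) r := by
        simpa using ((Complex.ofRealCLM.hasDerivAt (x := r)).const_mul Complex.I).fun_neg
      simpa [mul_comm] using h1.cexp
    have hi : ∀ (k : ℕ), iteratedDeriv k (fun r : ℝ => Complex.exp (-(Complex.I * (r : ℂ)))) =
        fun r : ℝ => (-Complex.I) ^ k * Complex.exp (-(Complex.I * (r : ℂ))) := by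
      intro k
      induction k with
      | zero => simp
      | succ k ih =>
        rw [iteratedDeriv_succ, ih]
        funext r
        rw [((hd r).const_mul ((-Complex.I) ^ k)).deriv]
        ring
    have hc : ContDiff ℝ ∞ (fun r : ℝ => Complex.exp (-(Complex.I * (r : ℂ)))) :=
      (contDiff_const.mul Complex.ofRealCLM.contDiff).neg.cexp
    refine ⟨hc, fun k => ⟨0, 1, fun r => ?_⟩⟩
    rw [norm_iteratedFDeriv_eq_norm_iteratedDeriv, hi]
    have : -(Complex.I * (r : ℂ)) = ((-r : ℝ) : ℂ) * Complex.I := by push_cast; ring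
    rw [norm_mul, this, Complex.norm_exp_ofReal_mul_I]
    simp
  have h2 : (fun ξ : Eucl n => t * ((2 * Real.pi) ^ 2 * ‖ξ‖ ^ 2)).HasTemperateGrowth := by
    fun_prop
  exact key.comp h2

/-- The free Schrödinger flow `e^{-itH₀}`, `H₀ = -Δ`, on tempered distributions. -/
def freeFlow (n : ℕ) (t : ℝ) : 𝓢'(Eucl n, ℂ) →L[ℂ] 𝓢'(Eucl n, ℂ) :=
  TemperedDistribution.fourierMultiplierCLM ℂ (freeSymbol n t)

/-- The operator `g(x - 2tP)`, `P = -i∇`. The commuting components of `x - 2tP` are the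
components of `x` conjugated by the free flow, `x - 2tP = e^{-itH₀} x e^{itH₀}`, hence
`g(x - 2tP) = e^{-itH₀} g(x) e^{itH₀}`. -/
def galileiFn (n : ℕ) (t : ℝ) (g : Eucl n → ℂ) : 𝓢'(Eucl n, ℂ) →L[ℂ] 𝓢'(Eucl n, ℂ) :=
  freeFlow n t ∘L TemperedDistribution.smulLeftCLM ℂ g ∘L freeFlow n (-t)

/-- `F` is a smooth characteristic function of the half line `[1, ∞)`. -/
structure IsSmoothCutoff (F : ℝ → ℝ) : Prop where
  smooth : ContDiff ℝ ∞ F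
  eq_zero : ∀ k ≤ 1 / 2, F k = 0
  eq_one : ∀ k ≥ 1, F k = 1

theorem IsSmoothCutoff.hasTemperateGrowth {F : ℝ → ℝ} (hF : IsSmoothCutoff F) (n : ℕ)
    {r : ℝ} (hr : 0 < r) :
    (fun x : Eucl n => ((F (‖x‖ / r) : ℝ) : ℂ)).HasTemperateGrowth := by
  have hs : ContDiff ℝ ∞ (fun x : Eucl n => 1 - F (‖x‖ / r)) := by
    refine contDiff_const.sub (contDiff_iff_contDiffAt.2 fun x => ?_)
    by_cases hx : x = 0
    · subst hx
      have hc : Continuous fun x : Eucl n => ‖x‖ / r := by fun_prop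
      have h0 : ∀ᶠ x in 𝓝 (0 : Eucl n), ‖x‖ / r < 1 / 2 :=
        hc.continuousAt.eventually_lt_const (by simp)
      refine (contDiffAt_const (c := (0 : ℝ))).congr_of_eventuallyEq ?_
      filter_upwards [h0] with x hx using hF.eq_zero _ hx.le
    · exact hF.smooth.contDiffAt.comp x ((contDiffAt_norm ℝ hx).div_const r)
  have hcs : HasCompactSupport (fun x : Eucl n => 1 - F (‖x‖ / r)) := by
    refine HasCompactSupport.intro (isCompact_closedBall (0 : Eucl n) r) fun x hx => ?_
    have : r < ‖x‖ := by simpa using hx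
    rw [hF.eq_one _ ((one_le_div hr).2 this.le), sub_self]
  have h := hcs.hasTemperateGrowth hs
  have h3 : (fun x : Eucl n => ((1 - (1 - F (‖x‖ / r)) : ℝ) : ℂ)).HasTemperateGrowth := by
    fun_prop
  simpa using h3

/-- The operator `F̄_c(|x - 2tP| / t^α > 1)`. -/
def outerCutoff (n : ℕ) (F : ℝ → ℝ) (α t : ℝ) : 𝓢'(Eucl n, ℂ) →L[ℂ] 𝓢'(Eucl n, ℂ) :=
  galileiFn n t (fun x => ((F (‖x‖ / t ^ α) : ℝ) : ℂ))

/-- The operator `F_c(|x - 2tP| / t^α ≤ 1)`, where `F_c(λ ≤ 1) = 1 - F̄_c(λ)`. -/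
def innerCutoff (n : ℕ) (F : ℝ → ℝ) (α t : ℝ) : 𝓢'(Eucl n, ℂ) →L[ℂ] 𝓢'(Eucl n, ℂ) :=
  galileiFn n t (fun x => ((1 - F (‖x‖ / t ^ α) : ℝ) : ℂ))

/-! ### Global solutions -/

/-- `ψ : ℝ → H^a(ℝⁿ)`, `a ≥ 0`, is a global (weak) solution of
`i ∂ₜψ - H₀ψ = N(x, t, |ψ|) ψ` with `H₀ = -Δ`, where `N` may depend on the whole function
`|ψ(t)|`: it is continuous in time in the sense of distributions, and
`⟨ψ(t), φ⟩ - ⟨ψ(0), φ⟩ = ∫₀ᵗ (i ⟨Δψ(s), φ⟩ - i ∫ N(x, s, |ψ(s)|) ψ(s, x) φ(x) dx) ds`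
for all `t` and all Schwartz functions `φ`. -/
structure IsGlobalSolution {n : ℕ} {a : ℝ} (ha : 0 ≤ a)
    (N : Eucl n → ℝ → (Eucl n → ℝ) → ℂ) (ψ : ℝ → SobolevSpace n a) : Prop where
  continuous : Continuous (fun t => SobolevSpace.toDistr (ψ t))
  equation : ∀ (φ : 𝓢(Eucl n, ℂ)) (t : ℝ),
    SobolevSpace.toDistr (ψ t) φ - SobolevSpace.toDistr (ψ 0) φ =
      ∫ s in (0 : ℝ)..t,
        (Complex.I * (Δ (SobolevSpace.toDistr (ψ s))) φ -
          Complex.I * ∫ x, N x s (fun y => ‖SobolevSpace.toL2 ha (ψ s) y‖) *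
            SobolevSpace.toL2 ha (ψ s) x * φ x)

end

/-!
# Free channel wave operators for time-dependent nonlinear Schrödinger equations

In the interaction picture `φ(t) = e^{itH₀} ψ(t)`, the operator `F_c(|x - 2tP| / t^α ≤ 1)` becomes
the multiplication of `φ(t)` by the cutoff `F_R(x) = 1 - F(|x| / R)`, `R = t^α`. The proof shows
that the bounded curve `φ(t)` converges weakly in `H^a` to some `Ω`, and that the local part
`F_{t^α} φ(t)` converges to `Ω` in norm; the three claims are reformulations of this.

The engine is a localised form of Cook's method. The interaction contributes `e^{isH₀} V(s) ψ(s)` to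
the time derivative of `φ`, and `V(s) ψ(s)` is bounded in `L¹` as a product of two `L²` functions.
The dispersive estimate `norm_schwartzMult_freeSymbol_le` bounds `e^{isH₀} V(s) ψ(s)` by
`O(s^{-n/2})` in `L^∞`, and multiplication by `F_R` turns this into an `L²` bound
`O(R^{n/2} s^{-n/2})`. The integral over `s ≥ t` is `O(R^{n/2} t^{1-n/2})`, since `n ≥ 3`
(`IsGlobalSolution.exists_norm_sub_le`). For fixed `R` it tends to zero, hence `φ(t)` has a weak
limit `Ω`; for `R = t^α` it still tends to zero, precisely because `α < 1 - 2/n`, hence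
`F_{t^α} (φ(t) - Ω) → 0`. Finally `F_R Ω → Ω` (`SobolevSpace.exists_tendsto_cutoff`).

The same bounds are needed in `H^a`, `0 ≤ a ≤ 1`. The `H^a` norm is characterised by `L²` norms of
increments `f(· + h) - f` at dyadic scales (`exists_isSobolevWeight`), so that a function belongs to
`H^a` when its increments are dominated by those of elements of `H^a` and of a Lipschitz function
(`SobolevSpace.exists_of_increments_le`). Translations commute with the free flow, and an increment
of `F_R e^{isH₀} (V ψ)` falls on `F_R`, on `V` or on `ψ`; in every case the `L²` estimate above
applies (`SobolevSpace.exists_norm_prodPairing_freeSymbol_le`). The increments also give the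
boundedness of the multiplication by `F_R` on `H^a`, uniformly in `R ≥ 1`.

All statements are tested against Schwartz functions: `H^a` is the dual of `H^{-a}`, whose norm of
`⟨P⟩^a κ` is `‖κ‖₂`. This avoids Bochner integrals of the interaction, and the equation is
integrated by an estimate of right difference quotients (`IsGlobalSolution.eventually_norm_sub_le`,
`norm_sub_le_of_right_slope`).
-/

noncomputable section

open FourierTransform

variable {n : ℕ}

/-! ### The bilinear pairing on `L²` -/

/-- Complex-valued square integrable functions on `ℝⁿ`. -/
abbrev L2 (n : ℕ) : Type := Lp ℂ 2 (volume : Measure (Eucl n))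

/-- The complex bilinear pairing `(f, g) ↦ ∫ f g` on `L²`; it is the one which the embedding of
`L²` into the tempered distributions uses. -/
def bilin (n : ℕ) : L2 n →L[ℂ] L2 n →L[ℂ] ℂ :=
  (ContinuousLinearMap.mul ℂ ℂ).lpPairing volume 2 2

theorem bilin_apply (f g : L2 n) : bilin n f g = ∫ x, f x * g x := by
  simp [bilin, ContinuousLinearMap.lpPairing_eq_integral]

theorem bilin_comm (f g : L2 n) : bilin n f g = bilin n g f := by
  simp only [bilin_apply, mul_comm]

theorem bilin_star (f g : L2 n) : bilin n f (star g) = inner ℂ g f := by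
  rw [bilin_apply, L2.inner_def]
  refine integral_congr_ae ?_
  filter_upwards [Lp.coeFn_star g] with x hx
  simp [hx, RCLike.inner_apply]

theorem L2.norm_star (f : L2 n) : ‖star f‖ = ‖f‖ := by
  rw [Lp.norm_def, Lp.norm_def]
  congr 1
  refine eLpNorm_congr_norm_ae ?_
  filter_upwards [Lp.coeFn_star f] with x hx
  rw [hx, Pi.star_apply, _root_.norm_star]

theorem norm_bilin_le (f g : L2 n) : ‖bilin n f g‖ ≤ ‖f‖ * ‖g‖ := by
  have h := bilin_star f (star g)
  rw [star_star] at h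
  rw [h]
  refine (norm_inner_le_norm _ _).trans ?_
  rw [L2.norm_star, mul_comm]

/-- The embedding of the Schwartz functions into `L²`. -/
def embL2 (n : ℕ) : 𝓢(Eucl n, ℂ) →L[ℂ] L2 n := SchwartzMap.toLpCLM ℂ ℂ 2 volume

theorem coeFn_embL2 (χ : 𝓢(Eucl n, ℂ)) : embL2 n χ =ᵐ[volume] χ := χ.coeFn_toLp 2

theorem toTemperedDistribution_apply_eq_bilin (f : L2 n) (χ : 𝓢(Eucl n, ℂ)) :
    Lp.toTemperedDistribution f χ = bilin n (embL2 n χ) f := by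
  rw [Lp.toTemperedDistribution_apply, bilin_apply]
  refine integral_congr_ae ?_
  filter_upwards [coeFn_embL2 χ] with x hx
  rw [hx, smul_eq_mul]

theorem denseRange_embL2 : DenseRange (embL2 n) :=
  SchwartzMap.denseRange_toLpCLM ENNReal.ofNat_ne_top

theorem norm_bilin_le_of_forall_schwartz {f : L2 n} {M : ℝ}
    (h : ∀ χ : 𝓢(Eucl n, ℂ), ‖bilin n (embL2 n χ) f‖ ≤ M * ‖embL2 n χ‖) (g : L2 n) :
    ‖bilin n g f‖ ≤ M * ‖g‖ := by
  refine denseRange_embL2.induction_on (p := fun g : L2 n => ‖bilin n g f‖ ≤ M * ‖g‖) g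
    ?_ h
  refine isClosed_le ?_ (by fun_prop)
  exact ((bilin n).flip f).continuous.norm

/-- The `L²` norm of `f` is tested by pairing `f` with Schwartz functions. -/
theorem norm_le_of_forall_bilin_schwartz_le {f : L2 n} {M : ℝ} (hM : 0 ≤ M)
    (h : ∀ χ : 𝓢(Eucl n, ℂ), ‖bilin n (embL2 n χ) f‖ ≤ M * ‖embL2 n χ‖) : ‖f‖ ≤ M := by
  have h2 := norm_bilin_le_of_forall_schwartz h (star f)
  rw [bilin_comm, bilin_star, L2.norm_star, inner_self_eq_norm_sq_to_K] at h2
  have h3 : ‖f‖ * ‖f‖ ≤ M * ‖f‖ := by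
    simpa [pow_two] using h2
  rcases (norm_nonneg f).eq_or_lt with h0 | h0
  · rwa [← h0]
  · exact le_of_mul_le_mul_right h3 h0

/-- A linear functional on the Schwartz functions which is bounded in the `L²` norm is the pairing
with a square integrable function. -/
theorem exists_L2_of_bounded_on_schwartz (l : 𝓢(Eucl n, ℂ) →ₗ[ℂ] ℂ) {M : ℝ} (hM : 0 ≤ M)
    (h : ∀ χ : 𝓢(Eucl n, ℂ), ‖l χ‖ ≤ M * ‖embL2 n χ‖) :
    ∃ f : L2 n, ‖f‖ ≤ M ∧ ∀ χ : 𝓢(Eucl n, ℂ), l χ = bilin n (embL2 n χ) f := by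
  let e : 𝓢(Eucl n, ℂ) →ₗ[ℂ] L2 n := (embL2 n).toLinearMap
  have he : DenseRange e := denseRange_embL2
  let L : StrongDual ℂ (L2 n) := l.extendOfNorm e
  let f : L2 n := star ((InnerProductSpace.toDual ℂ (L2 n)).symm L)
  have hf : ∀ χ : 𝓢(Eucl n, ℂ), l χ = bilin n (embL2 n χ) f := by
    intro χ
    rw [bilin_star, InnerProductSpace.toDual_symm_apply]
    exact (LinearMap.extendOfNorm_eq he ⟨M, h⟩ χ).symm
  refine ⟨f, norm_le_of_forall_bilin_schwartz_le hM fun χ => ?_, hf⟩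
  rw [← hf]
  exact h χ

/-- A bounded family in `L²` converges weakly as soon as it converges when tested against Schwartz
functions. -/
theorem tendsto_bilin_of_schwartz {ι : Type*} {F : Filter ι} {b : ι → L2 n} {b₀ : L2 n} {C : ℝ}
    (hb : ∀ᶠ i in F, ‖b i‖ ≤ C)
    (h : ∀ χ : 𝓢(Eucl n, ℂ),
      Tendsto (fun i => bilin n (embL2 n χ) (b i)) F (𝓝 (bilin n (embL2 n χ) b₀))) (g : L2 n) :
    Tendsto (fun i => bilin n g (b i)) F (𝓝 (bilin n g b₀)) := by
  have hC : 0 ≤ |C| := abs_nonneg C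
  rw [Metric.tendsto_nhds]
  intro ε hε
  set D : ℝ := |C| + ‖b₀‖ + 1 with hD
  have hDpos : 0 < D := by positivity
  obtain ⟨χ, hχ⟩ := denseRange_embL2.exists_dist_lt g (ε := ε / (2 * D)) (by positivity)
  filter_upwards [hb, Metric.tendsto_nhds.1 (h χ) (ε / 2) (by positivity)] with i hi hi'
  rw [dist_eq_norm] at hi' ⊢
  have e1 : bilin n g (b i) - bilin n g b₀ =
      bilin n (g - embL2 n χ) (b i - b₀) +
        (bilin n (embL2 n χ) (b i) - bilin n (embL2 n χ) b₀) := by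
    simp only [map_sub, _root_.sub_apply]
    ring
  rw [e1]
  have e2 : ‖bilin n (g - embL2 n χ) (b i - b₀)‖ ≤ ε / (2 * D) * D := by
    refine (norm_bilin_le _ _).trans ?_
    gcongr
    · rw [← dist_eq_norm]; exact hχ.le
    · refine (norm_sub_le _ _).trans ?_
      have := hi.trans (le_abs_self C)
      linarith
  have e3 : ε / (2 * D) * D = ε / 2 := by field_simp
  calc _ ≤ _ := norm_add_le _ _
    _ < ε := by linarith

/-- Every continuous linear functional on `L²` is a pairing with some function. -/
theorem exists_bilin_eq (l : StrongDual ℂ (L2 n)) : ∃ g : L2 n, ∀ f, l f = bilin n g f := by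
  refine ⟨star ((InnerProductSpace.toDual ℂ (L2 n)).symm l), fun f => ?_⟩
  rw [bilin_comm, bilin_star, InnerProductSpace.toDual_symm_apply]

/-! ### Fourier multipliers on Schwartz functions -/

/-- The transpose of the Fourier multiplier with symbol `m` on tempered distributions. -/
def schwartzMult (m : Eucl n → ℂ) : 𝓢(Eucl n, ℂ) →L[ℂ] 𝓢(Eucl n, ℂ) :=
  FourierTransform.fourierCLM ℂ 𝓢(Eucl n, ℂ) ∘L SchwartzMap.smulLeftCLM ℂ m ∘L
    FourierTransform.fourierInvCLM ℂ 𝓢(Eucl n, ℂ)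

theorem schwartzMult_apply (m : Eucl n → ℂ) (χ : 𝓢(Eucl n, ℂ)) :
    schwartzMult m χ = 𝓕 (SchwartzMap.smulLeftCLM ℂ m (𝓕⁻ χ)) := rfl

theorem fourierMultiplier_apply_eq (m : Eucl n → ℂ) (u : 𝓢'(Eucl n, ℂ)) (χ : 𝓢(Eucl n, ℂ)) :
    TemperedDistribution.fourierMultiplierCLM ℂ m u χ = u (schwartzMult m χ) := rfl

theorem schwartzMult_schwartzMult {m₁ m₂ : Eucl n → ℂ} (h₁ : m₁.HasTemperateGrowth)
    (h₂ : m₂.HasTemperateGrowth) (χ : 𝓢(Eucl n, ℂ)) :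
    schwartzMult m₁ (schwartzMult m₂ χ) = schwartzMult (m₁ * m₂) χ := by
  simp only [schwartzMult_apply, fourierInv_fourier_eq]
  rw [SchwartzMap.smulLeftCLM_smulLeftCLM_apply h₁ h₂]

theorem schwartzMult_comm {m₁ m₂ : Eucl n → ℂ} (h₁ : m₁.HasTemperateGrowth)
    (h₂ : m₂.HasTemperateGrowth) (χ : 𝓢(Eucl n, ℂ)) :
    schwartzMult m₁ (schwartzMult m₂ χ) = schwartzMult m₂ (schwartzMult m₁ χ) := by
  rw [schwartzMult_schwartzMult h₁ h₂, schwartzMult_schwartzMult h₂ h₁, mul_comm]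

theorem schwartzMult_one (χ : 𝓢(Eucl n, ℂ)) : schwartzMult (fun _ => 1) χ = χ := by
  simp [schwartzMult_apply]

theorem fourier_embL2 (χ : 𝓢(Eucl n, ℂ)) : 𝓕 (embL2 n χ) = embL2 n (𝓕 χ) :=
  SchwartzMap.toLp_fourier_eq χ

theorem norm_embL2_schwartzMult (m : Eucl n → ℂ) (χ : 𝓢(Eucl n, ℂ)) :
    ‖embL2 n (schwartzMult m χ)‖ =
      ‖embL2 n (SchwartzMap.smulLeftCLM ℂ m (𝓕⁻ χ))‖ := by
  rw [schwartzMult_apply, ← fourier_embL2, Lp.norm_fourier_eq]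

theorem norm_embL2_fourierInv (χ : 𝓢(Eucl n, ℂ)) :
    ‖embL2 n (𝓕⁻ χ)‖ = ‖embL2 n χ‖ := by
  have h : 𝓕 (𝓕⁻ χ) = χ := fourier_fourierInv_eq χ
  rw [← Lp.norm_fourier_eq, fourier_embL2, h]

theorem norm_embL2_le_of_forall_le {χ κ : 𝓢(Eucl n, ℂ)} {C : ℝ} (h : ∀ x, ‖χ x‖ ≤ C * ‖κ x‖) :
    ‖embL2 n χ‖ ≤ C * ‖embL2 n κ‖ := by
  refine Lp.norm_le_mul_norm_of_ae_le_mul ?_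
  filter_upwards [coeFn_embL2 χ, coeFn_embL2 κ] with x h1 h2
  rw [h1, h2]
  exact h x

theorem norm_embL2_schwartzMult_le {m : Eucl n → ℂ} (hm : m.HasTemperateGrowth) {C : ℝ}
    (hC : ∀ ξ, ‖m ξ‖ ≤ C) (χ : 𝓢(Eucl n, ℂ)) :
    ‖embL2 n (schwartzMult m χ)‖ ≤ C * ‖embL2 n χ‖ := by
  rw [norm_embL2_schwartzMult, ← norm_embL2_fourierInv χ]
  refine norm_embL2_le_of_forall_le fun ξ => ?_
  rw [SchwartzMap.smulLeftCLM_apply_apply hm, smul_eq_mul, norm_mul]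
  gcongr
  exact hC ξ

/-! ### The Sobolev space as a dual space -/

/-- The symbol `(1 + |ξ|²)^{s/2}` of the Bessel potential of order `s`. -/
def besselSymbol (n : ℕ) (s : ℝ) (ξ : Eucl n) : ℂ := (((1 + ‖ξ‖ ^ 2) ^ (s / 2) : ℝ) : ℂ)

theorem besselSymbol_hasTemperateGrowth (s : ℝ) : (besselSymbol n s).HasTemperateGrowth := by
  unfold besselSymbol
  fun_prop

theorem besselPotential_apply_eq (s : ℝ) (u : 𝓢'(Eucl n, ℂ)) (χ : 𝓢(Eucl n, ℂ)) :
    TemperedDistribution.besselPotential (Eucl n) ℂ s u χ = u (schwartzMult (besselSymbol n s) χ) :=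
  rfl

theorem schwartzMult_besselSymbol_neg (s : ℝ) (χ : 𝓢(Eucl n, ℂ)) :
    schwartzMult (besselSymbol n s) (schwartzMult (besselSymbol n (-s)) χ) = χ := by
  rw [schwartzMult_schwartzMult (besselSymbol_hasTemperateGrowth _)
    (besselSymbol_hasTemperateGrowth _)]
  rw [show besselSymbol n s * besselSymbol n (-s) = fun _ => 1 from ?_, schwartzMult_one]
  funext ξ
  change besselSymbol n s ξ * besselSymbol n (-s) ξ = 1
  unfold besselSymbol
  rw [← Complex.ofReal_mul, ← Real.rpow_add (by positivity)]
  simp [neg_div]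

namespace SobolevSpace

variable {a : ℝ}

theorem norm_eq (u : SobolevSpace n a) : ‖u‖ = ‖bessel u‖ := rfl

/-- The duality between `H^a` and `H^{-a}`: the test function `⟨P⟩^a κ` has norm `‖κ‖₂` in
`H^{-a}`. -/
theorem toDistr_besselSymbol (u : SobolevSpace n a) (κ : 𝓢(Eucl n, ℂ)) :
    toDistr u (schwartzMult (besselSymbol n a) κ) = bilin n (embL2 n κ) (bessel u) := by
  rw [← besselPotential_apply_eq, bessel_spec, toTemperedDistribution_apply_eq_bilin]

theorem toDistr_apply (u : SobolevSpace n a) (χ : 𝓢(Eucl n, ℂ)) :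
    toDistr u χ = bilin n (embL2 n (schwartzMult (besselSymbol n (-a)) χ)) (bessel u) := by
  rw [← toDistr_besselSymbol, schwartzMult_besselSymbol_neg]

theorem norm_toDistr_besselSymbol_le (u : SobolevSpace n a) (κ : 𝓢(Eucl n, ℂ)) :
    ‖toDistr u (schwartzMult (besselSymbol n a) κ)‖ ≤ ‖u‖ * ‖embL2 n κ‖ := by
  rw [toDistr_besselSymbol, norm_eq, mul_comm]
  exact norm_bilin_le _ _

theorem norm_le_of_forall_schwartz {u : SobolevSpace n a} {M : ℝ} (hM : 0 ≤ M)
    (h : ∀ κ : 𝓢(Eucl n, ℂ),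
      ‖toDistr u (schwartzMult (besselSymbol n a) κ)‖ ≤ M * ‖embL2 n κ‖) : ‖u‖ ≤ M :=
  norm_le_of_forall_bilin_schwartz_le hM fun κ => by
    rw [← toDistr_besselSymbol]
    exact h κ

theorem bessel_surjective : Function.Surjective (bessel (n := n) (a := a)) := by
  intro g
  have h : TemperedDistribution.besselPotential (Eucl n) ℂ a
      (TemperedDistribution.besselPotential (Eucl n) ℂ (-a) (g : 𝓢'(Eucl n, ℂ))) = g :=
    (TemperedDistribution.besselPotential_neg_apply_eq_iff a _ _).1 rfl
  refine ⟨⟨_, ⟨g, h⟩⟩, lp_toTemperedDistribution_injective ?_⟩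
  exact (bessel_spec _).symm.trans h

/-- The unitary operator `⟨P⟩^a` of `H^a` onto `L²`. -/
def besselEquiv (n : ℕ) (a : ℝ) : SobolevSpace n a ≃ₗᵢ[ℂ] L2 n :=
  LinearIsometryEquiv.ofSurjective ⟨bessel, fun _ => rfl⟩ bessel_surjective

theorem besselEquiv_apply (u : SobolevSpace n a) : besselEquiv n a u = bessel u := rfl

/-- `H^a` is the dual of `H^{-a}`: a linear functional on the Schwartz functions which is bounded
in the norm of `H^{-a}` belongs to `H^a`. -/
theorem exists_of_bounded_linear (l : 𝓢(Eucl n, ℂ) →ₗ[ℂ] ℂ) {M : ℝ} (hM : 0 ≤ M)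
    (h : ∀ κ : 𝓢(Eucl n, ℂ),
      ‖l (schwartzMult (besselSymbol n a) κ)‖ ≤ M * ‖embL2 n κ‖) :
    ∃ u : SobolevSpace n a, (∀ χ, toDistr u χ = l χ) ∧ ‖u‖ ≤ M := by
  obtain ⟨f, hf, hl⟩ := exists_L2_of_bounded_on_schwartz
    (l ∘ₗ (schwartzMult (besselSymbol n a)).toLinearMap) hM h
  obtain ⟨u, rfl⟩ := bessel_surjective (a := a) f
  refine ⟨u, fun χ => ?_, hf⟩
  rw [toDistr_apply, ← hl]
  change l (schwartzMult (besselSymbol n a) _) = _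
  rw [schwartzMult_besselSymbol_neg]

/-- Membership in `H^a` by duality, for a functional which is already a distribution. -/
theorem exists_of_bounded (u : 𝓢'(Eucl n, ℂ)) {M : ℝ} (hM : 0 ≤ M)
    (h : ∀ κ : 𝓢(Eucl n, ℂ),
      ‖u (schwartzMult (besselSymbol n a) κ)‖ ≤ M * ‖embL2 n κ‖) :
    ∃ w : SobolevSpace n a, toDistr w = u ∧ ‖w‖ ≤ M := by
  obtain ⟨w, hw, hwM⟩ := exists_of_bounded_linear (a := a)
    (show 𝓢(Eucl n, ℂ) →ₗ[ℂ] ℂ from ⟨⟨u, map_add u⟩, map_smul u⟩) hM h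
  exact ⟨w, by ext χ; exact hw χ, hwM⟩

/-- A bounded family in `H^a` which converges as a distribution converges weakly in `H^a`. -/
theorem tendsto_dual_of_tendsto_distr {ι : Type*} {F : Filter ι} {w : ι → SobolevSpace n a}
    {v : SobolevSpace n a} {C : ℝ} (hw : ∀ᶠ i in F, ‖w i‖ ≤ C)
    (h : ∀ χ, Tendsto (fun i => toDistr (w i) χ) F (𝓝 (toDistr v χ)))
    (l : StrongDual ℂ (SobolevSpace n a)) : Tendsto (fun i => l (w i)) F (𝓝 (l v)) := by
  obtain ⟨g, hg⟩ := exists_bilin_eq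
    (l ∘L (besselEquiv n a).symm.toContinuousLinearEquiv.toContinuousLinearMap)
  have hl : ∀ u : SobolevSpace n a, l u = bilin n g (bessel u) := by
    intro u
    rw [← hg, ← besselEquiv_apply]
    simp
  simp only [hl]
  refine tendsto_bilin_of_schwartz (C := C) hw (fun κ => ?_) g
  simp only [← toDistr_besselSymbol]
  exact h _

/-- Fourier multipliers with a bounded symbol are bounded on `H^a`. -/
theorem exists_fourierMultiplier {m : Eucl n → ℂ} (hm : m.HasTemperateGrowth) {C : ℝ}
    (hC0 : 0 ≤ C) (hC : ∀ ξ, ‖m ξ‖ ≤ C) (u : SobolevSpace n a) :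
    ∃ w : SobolevSpace n a,
      toDistr w = TemperedDistribution.fourierMultiplierCLM ℂ m (toDistr u) ∧ ‖w‖ ≤ C * ‖u‖ := by
  refine exists_of_bounded _ (by positivity) fun κ => ?_
  rw [fourierMultiplier_apply_eq, schwartzMult_comm hm (besselSymbol_hasTemperateGrowth _)]
  refine (norm_toDistr_besselSymbol_le _ _).trans ?_
  rw [mul_assoc, mul_left_comm]
  gcongr
  exact norm_embL2_schwartzMult_le hm hC κ

end SobolevSpace

/-! ### Bounded multipliers and translations on `L²` -/

theorem memLp_top_of_bounded {m : Eucl n → ℂ} (hm : Continuous m) {C : ℝ}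
    (hC : ∀ x, ‖m x‖ ≤ C) : MemLp m ∞ volume :=
  memLp_top_of_bound hm.aestronglyMeasurable C (Eventually.of_forall hC)

/-- Multiplication by a bounded function of temperate growth, as distributions and pointwise. -/
theorem exists_L2_smul {m : Eucl n → ℂ} (hm : m.HasTemperateGrowth) {C : ℝ}
    (hC : ∀ x, ‖m x‖ ≤ C) (f : L2 n) :
    ∃ g : L2 n, (g : 𝓢'(Eucl n, ℂ)) =
      TemperedDistribution.smulLeftCLM ℂ m (f : 𝓢'(Eucl n, ℂ)) ∧
        g =ᵐ[volume] fun x => m x * f x := by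
  have h := memLp_top_of_bounded hm.1.continuous hC
  refine ⟨h.toLp m • f, Lp.toTemperedDistribution_smul_eq hm h f, ?_⟩
  filter_upwards [Lp.coeFn_lpSMul (r := 2) (h.toLp m) f, h.coeFn_toLp] with x h1 h2
  rw [h1]
  simp [h2]

/-- On the Fourier side a multiplier with bounded symbol acts by pointwise multiplication. -/
theorem fourier_ae_eq_of_fourierMultiplier {m : Eucl n → ℂ} (hm : m.HasTemperateGrowth) {C : ℝ}
    (hC : ∀ x, ‖m x‖ ≤ C) {f g : L2 n}
    (h : (f : 𝓢'(Eucl n, ℂ)) =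
      TemperedDistribution.fourierMultiplierCLM ℂ m (g : 𝓢'(Eucl n, ℂ))) :
    (𝓕 f : L2 n) =ᵐ[volume] fun ξ => m ξ * (𝓕 g : L2 n) ξ := by
  obtain ⟨k, hk, hk'⟩ := exists_L2_smul hm hC (𝓕 g : L2 n)
  have : (𝓕 f : L2 n) = k := by
    apply SobolevSpace.lp_toTemperedDistribution_injective
    change Lp.toTemperedDistribution _ = Lp.toTemperedDistribution _
    rw [hk, ← Lp.fourier_toTemperedDistribution_eq, h, ← Lp.fourier_toTemperedDistribution_eq,
      TemperedDistribution.fourierMultiplierCLM_apply]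
    exact fourier_fourierInv_eq _
  rw [this]
  exact hk'

theorem measurePreserving_add_const (h : Eucl n) :
    MeasurePreserving (fun x : Eucl n => x + h) volume volume :=
  measurePreserving_add_right volume h

/-- The translation `(T_h f)(x) = f(x + h)` on `L²`. -/
def transL2 (h : Eucl n) : L2 n →ₗᵢ[ℂ] L2 n :=
  Lp.compMeasurePreservingₗᵢ ℂ (fun x : Eucl n => x + h) (measurePreserving_add_const h)

theorem coeFn_transL2 (h : Eucl n) (f : L2 n) :
    transL2 h f =ᵐ[volume] fun x => f (x + h) :=
  Lp.coeFn_compMeasurePreserving f (measurePreserving_add_const h)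

/-- The character `e^{2πi h·ξ}`, the symbol of the translation by `h`. -/
def charSymbol (h ξ : Eucl n) : ℂ :=
  Complex.exp (((2 * Real.pi * inner ℝ h ξ : ℝ) : ℂ) * Complex.I)

theorem norm_charSymbol (h ξ : Eucl n) : ‖charSymbol h ξ‖ = 1 := Complex.norm_exp_ofReal_mul_I _

theorem hasTemperateGrowth_exp_ofReal_mul_I :
    (fun r : ℝ => Complex.exp ((r : ℂ) * Complex.I)).HasTemperateGrowth := by
  have hd : ∀ r : ℝ, HasDerivAt (fun r : ℝ => Complex.exp ((r : ℂ) * Complex.I))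
      (Complex.I * Complex.exp ((r : ℂ) * Complex.I)) r := by
    intro r
    have h1 : HasDerivAt (fun r : ℝ => (r : ℂ) * Complex.I) Complex.I r := by
      simpa using (Complex.ofRealCLM.hasDerivAt (x := r)).mul_const Complex.I
    simpa [mul_comm] using h1.cexp
  have hi : ∀ k : ℕ, iteratedDeriv k (fun r : ℝ => Complex.exp ((r : ℂ) * Complex.I)) =
      fun r : ℝ => Complex.I ^ k * Complex.exp ((r : ℂ) * Complex.I) := by
    intro k
    induction k with
    | zero => simp
    | succ k ih =>
      rw [iteratedDeriv_succ, ih]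
      funext r
      rw [((hd r).const_mul (Complex.I ^ k)).deriv]
      ring
  have hc : ContDiff ℝ ∞ (fun r : ℝ => Complex.exp ((r : ℂ) * Complex.I)) :=
    (Complex.ofRealCLM.contDiff.mul contDiff_const).cexp
  refine ⟨hc, fun k => ⟨0, 1, fun r => ?_⟩⟩
  rw [norm_iteratedFDeriv_eq_norm_iteratedDeriv, hi, norm_mul, Complex.norm_exp_ofReal_mul_I]
  simp

theorem charSymbol_hasTemperateGrowth (h : Eucl n) : (charSymbol h).HasTemperateGrowth := by
  have h2 : (fun ξ : Eucl n => 2 * Real.pi * inner ℝ h ξ).HasTemperateGrowth := by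
    fun_prop
  exact hasTemperateGrowth_exp_ofReal_mul_I.comp h2

/-- On test functions, the transpose of the translation `f ↦ f(· + h)` is `χ ↦ χ(· - h)`. -/
theorem schwartzMult_charSymbol (h : Eucl n) (χ : 𝓢(Eucl n, ℂ)) :
    schwartzMult (charSymbol h) χ = SchwartzMap.compSubConstCLM ℂ h χ := by
  ext x
  have h1 : χ = 𝓕 (𝓕⁻ χ) := (fourier_fourierInv_eq χ).symm
  rw [SchwartzMap.compSubConstCLM_apply, schwartzMult_apply]
  conv_rhs => rw [h1]
  rw [SchwartzMap.fourier_coe, SchwartzMap.fourier_coe, Real.fourier_eq', Real.fourier_eq']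
  congr 1
  ext ξ
  rw [SchwartzMap.smulLeftCLM_apply_apply (charSymbol_hasTemperateGrowth h), smul_eq_mul,
    smul_eq_mul, smul_eq_mul, ← mul_assoc, charSymbol, ← Complex.exp_add, inner_sub_right,
    real_inner_comm ξ h]
  congr 2
  push_cast
  ring

theorem bilin_transL2 (h : Eucl n) (χ : 𝓢(Eucl n, ℂ)) (f : L2 n) :
    bilin n (embL2 n χ) (transL2 h f) =
      bilin n (embL2 n (SchwartzMap.compSubConstCLM ℂ h χ)) f := by
  rw [bilin_apply, bilin_apply]
  have h1 : ∫ x, (embL2 n χ) x * (transL2 h f) x = ∫ x, χ (x + h - h) * f (x + h) := by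
    refine integral_congr_ae ?_
    filter_upwards [coeFn_embL2 χ, coeFn_transL2 h f] with x h1 h2
    rw [h1, h2, add_sub_cancel_right]
  rw [h1, integral_add_right_eq_self (fun x => χ (x - h) * f x) h]
  refine integral_congr_ae ?_
  filter_upwards [coeFn_embL2 (SchwartzMap.compSubConstCLM ℂ h χ)] with x h1
  rw [h1, SchwartzMap.compSubConstCLM_apply]

theorem transL2_toTemperedDistribution (h : Eucl n) (f : L2 n) :
    (transL2 h f : 𝓢'(Eucl n, ℂ)) =
      TemperedDistribution.fourierMultiplierCLM ℂ (charSymbol h) (f : 𝓢'(Eucl n, ℂ)) := by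
  ext χ
  rw [fourierMultiplier_apply_eq, toTemperedDistribution_apply_eq_bilin,
    toTemperedDistribution_apply_eq_bilin, bilin_transL2, schwartzMult_charSymbol]

theorem enorm_sq_eq_lintegral (f : L2 n) : ‖f‖ₑ ^ 2 = ∫⁻ x, ‖f x‖ₑ ^ 2 := by
  rw [Lp.enorm_def, eLpNorm_eq_lintegral_rpow_enorm_toReal (by norm_num) (by norm_num)]
  simp only [ENNReal.toReal_ofNat, ENNReal.rpow_ofNat]
  rw [← ENNReal.rpow_natCast, ← ENNReal.rpow_mul]
  norm_num

theorem enorm_fourier_eq (f : L2 n) : ‖(𝓕 f : L2 n)‖ₑ = ‖f‖ₑ := by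
  rw [← ofReal_norm, ← ofReal_norm, Lp.norm_fourier_eq]

theorem enorm_transL2_sub_sq (h : Eucl n) (f : L2 n) :
    ‖transL2 h f - f‖ₑ ^ 2 =
      ∫⁻ ξ, ENNReal.ofReal (‖charSymbol h ξ - 1‖ ^ 2) * ‖(𝓕 f : L2 n) ξ‖ₑ ^ 2 := by
  have h1 := fourier_ae_eq_of_fourierMultiplier (charSymbol_hasTemperateGrowth h)
    (fun ξ => (norm_charSymbol h ξ).le) (transL2_toTemperedDistribution h f)
  rw [← enorm_fourier_eq, enorm_sq_eq_lintegral,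
    show (𝓕 (transL2 h f - f) : L2 n) = 𝓕 (transL2 h f) - 𝓕 f from
      (Lp.fourierTransformₗᵢ (Eucl n) ℂ).map_sub _ _]
  refine lintegral_congr_ae ?_
  filter_upwards [h1, Lp.coeFn_sub (𝓕 (transL2 h f) : L2 n) (𝓕 f)] with ξ h2 h3
  rw [h3, Pi.sub_apply, h2, ← sub_one_mul, enorm_mul, mul_pow, ENNReal.ofReal_pow (norm_nonneg _),
    ofReal_norm]

/-! ### The Sobolev norm on the Fourier side -/

theorem enorm_besselSymbol_sq (s : ℝ) (ξ : Eucl n) :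
    ‖besselSymbol n s ξ‖ₑ ^ 2 = ENNReal.ofReal ((1 + ‖ξ‖ ^ 2) ^ s) := by
  rw [besselSymbol, ← ofReal_norm (Complex.ofReal _), ← ENNReal.ofReal_pow (norm_nonneg _),
    Complex.norm_real, Real.norm_of_nonneg (by positivity), ← Real.rpow_mul_natCast (by positivity)]
  simp

namespace SobolevSpace

variable {a : ℝ}

theorem fourier_toL2_ae_eq (ha : 0 ≤ a) (u : SobolevSpace n a) :
    (𝓕 (toL2 ha u) : L2 n) =ᵐ[volume]
      fun ξ => besselSymbol n (-a) ξ * (𝓕 (bessel u) : L2 n) ξ := by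
  refine fourier_ae_eq_of_fourierMultiplier (besselSymbol_hasTemperateGrowth _) (C := 1) ?_ ?_
  · intro ξ
    rw [besselSymbol, Complex.norm_real, Real.norm_of_nonneg (by positivity)]
    exact Real.rpow_le_one_of_one_le_of_nonpos (by simp) (by linarith)
  · rw [← toL2_spec, ← bessel_spec]
    exact ((TemperedDistribution.besselPotential_neg_apply_eq_iff a _ _).2 rfl).symm

theorem enorm_sq_eq_lintegral (ha : 0 ≤ a) (u : SobolevSpace n a) :
    ‖u‖ₑ ^ 2 = ∫⁻ ξ, ENNReal.ofReal ((1 + ‖ξ‖ ^ 2) ^ a) * ‖(𝓕 (toL2 ha u) : L2 n) ξ‖ₑ ^ 2 := by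
  have h0 : ‖u‖ₑ = ‖(𝓕 (bessel u) : L2 n)‖ₑ := by
    rw [enorm_fourier_eq, ← ofReal_norm, ← ofReal_norm, norm_eq]
  rw [h0, _root_.enorm_sq_eq_lintegral]
  refine lintegral_congr_ae ?_
  filter_upwards [fourier_toL2_ae_eq ha u] with ξ hξ
  rw [hξ, enorm_mul, mul_pow, ← mul_assoc, enorm_besselSymbol_sq,
    ← ENNReal.ofReal_mul (by positivity), ← Real.rpow_add (by positivity)]
  simp

/-- A square integrable function with finite Sobolev norm on the Fourier side belongs to `H^a`. -/
theorem exists_of_lintegral_le (ha : 0 ≤ a) (f : L2 n) {M : ℝ} (hM : 0 ≤ M)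
    (h : ∫⁻ ξ, ENNReal.ofReal ((1 + ‖ξ‖ ^ 2) ^ a) * ‖(𝓕 f : L2 n) ξ‖ₑ ^ 2 ≤
      ENNReal.ofReal M ^ 2) :
    ∃ u : SobolevSpace n a, toL2 ha u = f ∧ ‖u‖ ≤ M := by
  have hcont : Continuous (besselSymbol n a) := (besselSymbol_hasTemperateGrowth a).1.continuous
  have hk : MemLp (fun ξ => besselSymbol n a ξ * (𝓕 f : L2 n) ξ) 2 volume := by
    refine ⟨hcont.aestronglyMeasurable.mul (Lp.aestronglyMeasurable _), ?_⟩
    rw [eLpNorm_lt_top_iff_lintegral_rpow_enorm_lt_top (by norm_num) (by norm_num)]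
    refine lt_of_le_of_lt ?_ (lt_of_le_of_lt h (by simp))
    refine lintegral_mono fun ξ => le_of_eq ?_
    simp only [ENNReal.toReal_ofNat, ENNReal.rpow_ofNat]
    rw [enorm_mul, mul_pow, enorm_besselSymbol_sq]
  obtain ⟨u, hu⟩ := bessel_surjective (a := a) (𝓕⁻ (hk.toLp _) : L2 n)
  have h1 : (𝓕 (bessel u) : L2 n) = hk.toLp _ := by
    rw [hu]; exact fourier_fourierInv_eq _
  have h2 : toL2 ha u = f := by
    apply (Lp.fourierTransformₗᵢ (Eucl n) ℂ).injective
    change (𝓕 (toL2 ha u) : L2 n) = 𝓕 f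
    refine Lp.ext ?_
    filter_upwards [fourier_toL2_ae_eq ha u, hk.coeFn_toLp] with ξ h3 h4
    rw [h3, h1, h4, ← mul_assoc, besselSymbol, besselSymbol, ← Complex.ofReal_mul,
      ← Real.rpow_add (by positivity)]
    simp [neg_div]
  refine ⟨u, h2, ?_⟩
  rw [← h2, ← enorm_sq_eq_lintegral] at h
  have h5 := (ENNReal.pow_le_pow_left_iff (n := 2) (by norm_num)).1 h
  rwa [← ofReal_norm, ENNReal.ofReal_le_ofReal_iff hM] at h5

theorem norm_toL2_le (ha : 0 ≤ a) (u : SobolevSpace n a) : ‖toL2 ha u‖ ≤ ‖u‖ := by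
  have h : ‖toL2 ha u‖ₑ ^ 2 ≤ ‖u‖ₑ ^ 2 := by
    rw [enorm_sq_eq_lintegral ha, ← enorm_fourier_eq, _root_.enorm_sq_eq_lintegral]
    refine lintegral_mono fun ξ => ?_
    refine le_mul_of_one_le_left zero_le ?_
    rw [ENNReal.one_le_ofReal]
    exact Real.one_le_rpow (by simp) ha
  have h5 := (ENNReal.pow_le_pow_left_iff (n := 2) (by norm_num)).1 h
  rwa [← ofReal_norm, ← ofReal_norm, ENNReal.ofReal_le_ofReal_iff (norm_nonneg _)] at h5

end SobolevSpace

/-! ### Difference quotients and the Sobolev norm -/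

theorem norm_exp_sub_one_sq_le (s : ℝ) :
    ‖Complex.exp (((2 * Real.pi * s : ℝ) : ℂ) * Complex.I) - 1‖ ^ 2 ≤ 40 * min 1 (s ^ 2) := by
  rw [mul_comm _ Complex.I, Complex.norm_exp_I_mul_ofReal_sub_one, Real.norm_eq_abs, sq_abs,
    show 2 * Real.pi * s / 2 = Real.pi * s by ring]
  have h1 : Real.sin (Real.pi * s) ^ 2 ≤ 1 := Real.sin_sq_le_one _
  have h2 : Real.sin (Real.pi * s) ^ 2 ≤ (Real.pi * s) ^ 2 := by
    rw [← sq_abs (Real.sin _), ← sq_abs (Real.pi * s)]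
    have := Real.abs_sin_le_abs (x := Real.pi * s)
    gcongr
  have h3 : Real.pi ^ 2 ≤ 10 := by nlinarith [Real.pi_lt_d2, Real.pi_pos]
  rw [mul_min_of_nonneg _ _ (by norm_num)]
  refine le_min (by nlinarith) ?_
  nlinarith [mul_le_mul_of_nonneg_right h3 (sq_nonneg s)]

theorem le_norm_exp_sub_one_sq {s : ℝ} (hs : |s| ≤ 1 / 2) :
    16 * s ^ 2 ≤ ‖Complex.exp (((2 * Real.pi * s : ℝ) : ℂ) * Complex.I) - 1‖ ^ 2 := by
  rw [mul_comm _ Complex.I, Complex.norm_exp_I_mul_ofReal_sub_one, Real.norm_eq_abs, sq_abs,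
    show 2 * Real.pi * s / 2 = Real.pi * s by ring]
  have h : 2 * |s| ≤ |Real.sin (Real.pi * s)| := by
    have h1 := Real.mul_abs_le_abs_sin (x := Real.pi * s) (by
      rw [abs_mul, abs_of_pos Real.pi_pos]; nlinarith [Real.pi_pos])
    rw [abs_mul, abs_of_pos Real.pi_pos] at h1
    calc 2 * |s| = 2 / Real.pi * (Real.pi * |s|) := by field_simp
      _ ≤ _ := h1
  have h2 : (2 * |s|) ^ 2 ≤ |Real.sin (Real.pi * s)| ^ 2 := by gcongr
  rw [sq_abs, mul_pow, sq_abs] at h2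
  nlinarith

/-- The upper bound for the dyadic Gagliardo weights: the terms grow geometrically up to the scale
`4^k ≈ y` and decay geometrically beyond it. -/
theorem sum_rpow_mul_min_le {a : ℝ} (ha0 : 0 < a) (ha1 : a < 1) :
    ∃ C : ℝ, 0 < C ∧ ∀ (K : ℕ) (y : ℝ), 1 ≤ y →
      ∑ k ∈ Finset.range (K + 1), ((4 : ℝ) ^ a) ^ k * min 1 (y / 4 ^ k) ≤ C * y ^ a := by
  set q : ℝ := (4 : ℝ) ^ a with hq
  have hq1 : 1 < q := Real.one_lt_rpow (by norm_num) ha0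
  have hq4 : q < 4 := by
    calc q < (4 : ℝ) ^ (1 : ℝ) := Real.rpow_lt_rpow_of_exponent_lt (by norm_num) ha1
      _ = 4 := Real.rpow_one 4
  have hσ : q / 4 < 1 := by linarith
  refine ⟨q / (q - 1) + 4 / (1 - q / 4), ?_, fun K y hy => ?_⟩
  · have : 0 < q - 1 := by linarith
    have : 0 < 1 - q / 4 := by linarith
    positivity
  obtain ⟨m, hm1, hm2⟩ := exists_nat_pow_near hy (by norm_num : (1 : ℝ) < 4)
  have hqm : q ^ m ≤ y ^ a := by
    rw [hq, ← Real.rpow_natCast, ← Real.rpow_mul (by norm_num), mul_comm,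
      Real.rpow_mul (by norm_num), Real.rpow_natCast]
    exact Real.rpow_le_rpow (by positivity) hm1 ha0.le
  have hsub : Finset.range (K + 1) ⊆ Finset.range (m + 1) ∪ Finset.Ico m (K + 1) := by
    intro k hk
    simp only [Finset.mem_range, Finset.mem_union, Finset.mem_Ico] at hk ⊢
    omega
  have hnn : ∀ k, 0 ≤ q ^ k * min 1 (y / 4 ^ k) := fun k => by positivity
  have h1 : ∑ k ∈ Finset.range (m + 1), q ^ k * min 1 (y / 4 ^ k) ≤ q / (q - 1) * y ^ a := by
    calc _ ≤ ∑ k ∈ Finset.range (m + 1), q ^ k := by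
          refine Finset.sum_le_sum fun k _ => ?_
          exact mul_le_of_le_one_right (by positivity) (min_le_left _ _)
      _ = (q ^ (m + 1) - 1) / (q - 1) := geom_sum_eq hq1.ne' _
      _ ≤ q ^ (m + 1) / (q - 1) := by
          have : 0 < q - 1 := by linarith
          gcongr
          linarith
      _ = q / (q - 1) * q ^ m := by ring
      _ ≤ _ := by
          have : 0 < q - 1 := by linarith
          gcongr
  have h2 : ∑ k ∈ Finset.Ico m (K + 1), q ^ k * min 1 (y / 4 ^ k) ≤
      4 / (1 - q / 4) * y ^ a := by
    have hp : 0 < 1 - q / 4 := by linarith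
    calc _ ≤ ∑ k ∈ Finset.Ico m (K + 1), y * (q / 4) ^ k := by
          refine Finset.sum_le_sum fun k _ => ?_
          calc q ^ k * min 1 (y / 4 ^ k) ≤ q ^ k * (y / 4 ^ k) := by
                gcongr
                exact min_le_right _ _
            _ = _ := by rw [div_pow]; ring
      _ = y * ∑ k ∈ Finset.Ico m (K + 1), (q / 4) ^ k := by rw [Finset.mul_sum]
      _ ≤ y * ((q / 4) ^ m / (1 - q / 4)) := by
          gcongr
          exact geom_sum_Ico_le_of_lt_one (by positivity) hσ
      _ = y / 4 ^ m * q ^ m / (1 - q / 4) := by rw [div_pow]; ring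
      _ ≤ 4 * y ^ a / (1 - q / 4) := by
          have h4 : y / 4 ^ m ≤ 4 := by
            rw [div_le_iff₀ (by positivity)]
            rw [pow_succ] at hm2
            linarith
          gcongr
      _ = _ := by ring
  calc _ ≤ ∑ k ∈ Finset.range (m + 1) ∪ Finset.Ico m (K + 1), q ^ k * min 1 (y / 4 ^ k) :=
        Finset.sum_le_sum_of_subset_of_nonneg hsub fun k _ _ => hnn k
    _ ≤ ∑ k ∈ Finset.range (m + 1), q ^ k * min 1 (y / 4 ^ k) +
          ∑ k ∈ Finset.Ico m (K + 1), q ^ k * min 1 (y / 4 ^ k) := by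
        rw [← Finset.sum_union_inter (s₁ := Finset.range (m + 1))]
        exact le_add_of_nonneg_right (Finset.sum_nonneg fun k _ => hnn k)
    _ ≤ _ := by
        rw [add_mul]
        exact add_le_add h1 h2

/-- Weights for which the weighted sums of the squared increments at the scales `2^{-k}` recover
the power `|s|^{2a}`, `0 ≤ a ≤ 1`. For `0 < a < 1` these are the weights `2^{2ak}` of the
(dyadic) Gagliardo seminorm; for `a = 1` only the finest scale is kept, which gives difference
quotients, and for `a = 0` no increment is needed. -/
theorem exists_scale_weights {a : ℝ} (ha0 : 0 ≤ a) (ha1 : a ≤ 1) :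
    ∃ (w : ℕ → ℕ → ℝ) (C : ℝ), 0 < C ∧ (∀ K k, 0 ≤ w K k) ∧
      (∀ (K : ℕ) (y : ℝ), 1 ≤ y →
        ∑ k ∈ Finset.range (K + 1), w K k * min 1 (y / 4 ^ k) ≤ C * y ^ a) ∧
      ∀ s : ℝ, ∀ᶠ K in atTop, (s ^ 2) ^ a ≤ 1 + ∑ k ∈ Finset.range (K + 1), w K k *
        ‖Complex.exp (((2 * Real.pi * (s / 2 ^ k) : ℝ) : ℂ) * Complex.I) - 1‖ ^ 2 := by
  rcases ha0.eq_or_lt with rfl | ha0'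
  · refine ⟨fun _ _ => 0, 1, one_pos, fun _ _ => le_rfl, fun K y hy => by simp, fun s => ?_⟩
    simp
  rcases ha1.eq_or_lt with rfl | ha1'
  · refine ⟨fun K k => if k = K then 4 ^ K else 0, 1, one_pos, fun K k => by positivity,
      fun K y hy => ?_, fun s => ?_⟩
    · simp only [ite_mul, zero_mul, Finset.sum_ite_eq', Finset.mem_range, Nat.lt_succ_self, if_true,
        Real.rpow_one, one_mul]
      calc (4 : ℝ) ^ K * min 1 (y / 4 ^ K) ≤ 4 ^ K * (y / 4 ^ K) := by
            gcongr
            exact min_le_right _ _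
        _ = y := by field_simp
    · obtain ⟨K₀, hK₀⟩ := pow_unbounded_of_one_lt (2 * |s|) (by norm_num : (1 : ℝ) < 2)
      filter_upwards [eventually_ge_atTop K₀] with K hK
      simp only [ite_mul, zero_mul, Finset.sum_ite_eq', Finset.mem_range, Nat.lt_succ_self, if_true,
        Real.rpow_one]
      have h1 : |s / 2 ^ K| ≤ 1 / 2 := by
        rw [abs_div, abs_of_pos (by positivity : (0 : ℝ) < 2 ^ K), div_le_iff₀ (by positivity)]
        have : (2 : ℝ) ^ K₀ ≤ 2 ^ K := pow_le_pow_right₀ (by norm_num) hK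
        linarith
      have h2 := mul_le_mul_of_nonneg_left (le_norm_exp_sub_one_sq h1)
        (by positivity : (0 : ℝ) ≤ 4 ^ K)
      have h3 : (4 : ℝ) ^ K * (16 * (s / 2 ^ K) ^ 2) = 16 * s ^ 2 := by
        rw [div_pow, ← pow_mul, mul_comm K 2, pow_mul]
        norm_num
        field_simp
      rw [h3] at h2
      nlinarith [sq_nonneg s]
  · obtain ⟨C, hC, h⟩ := sum_rpow_mul_min_le ha0' ha1'
    refine ⟨fun _ k => ((4 : ℝ) ^ a) ^ k, C, hC, fun _ k => by positivity, h, fun s => ?_⟩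
    rcases le_or_gt |s| 1 with hs | hs
    · refine Eventually.of_forall fun K => ?_
      have h1 : (s ^ 2) ^ a ≤ 1 := Real.rpow_le_one (sq_nonneg s) (by
        rw [← sq_abs]; exact pow_le_one₀ (abs_nonneg s) hs) ha0
      have h2 : 0 ≤ ∑ k ∈ Finset.range (K + 1), ((4 : ℝ) ^ a) ^ k *
        ‖Complex.exp (((2 * Real.pi * (s / 2 ^ k) : ℝ) : ℂ) * Complex.I) - 1‖ ^ 2 :=
        Finset.sum_nonneg fun k _ => by positivity
      linarith
    -- for `1/4 ≤ |s| / 2^(m+1) ≤ 1/2` the single scale `m + 1` already gives the bound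
    · obtain ⟨m, hm1, hm2⟩ := exists_nat_pow_near (by linarith : 1 ≤ 2 * |s|)
        (by norm_num : (1 : ℝ) < 2)
      filter_upwards [eventually_ge_atTop (m + 1)] with K hK
      have h1 : |s / 2 ^ (m + 1)| ≤ 1 / 2 := by
        rw [abs_div, abs_of_pos (by positivity : (0 : ℝ) < 2 ^ (m + 1)), div_le_iff₀ (by positivity)]
        linarith
      have h2 : 1 / 4 ≤ |s / 2 ^ (m + 1)| := by
        rw [abs_div, abs_of_pos (by positivity : (0 : ℝ) < 2 ^ (m + 1)), le_div_iff₀ (by positivity),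
          pow_succ]
        linarith
      have h3 : 1 ≤ ‖Complex.exp (((2 * Real.pi * (s / 2 ^ (m + 1)) : ℝ) : ℂ) * Complex.I)
          - 1‖ ^ 2 := by
        refine le_trans ?_ (le_norm_exp_sub_one_sq h1)
        rw [← sq_abs]
        nlinarith
      have h4 : (s ^ 2) ^ a ≤ ((4 : ℝ) ^ a) ^ (m + 1) := by
        have h40 : ((4 : ℝ) ^ a) ^ (m + 1) = ((4 : ℝ) ^ (m + 1)) ^ a := by
          rw [← Real.rpow_natCast, ← Real.rpow_mul (by norm_num), mul_comm,
            Real.rpow_mul (by norm_num), Real.rpow_natCast]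
        rw [h40]
        refine Real.rpow_le_rpow (sq_nonneg s) ?_ ha0
        rw [show (4 : ℝ) = 2 ^ 2 by norm_num, ← pow_mul, mul_comm, pow_mul, ← sq_abs]
        exact pow_le_pow_left₀ (abs_nonneg s) (by linarith) 2
      have h5 := Finset.single_le_sum (s := Finset.range (K + 1)) (f := fun k => ((4 : ℝ) ^ a) ^ k *
        ‖Complex.exp (((2 * Real.pi * (s / 2 ^ k) : ℝ) : ℂ) * Complex.I) - 1‖ ^ 2)
        (fun k _ => by positivity) (Finset.mem_range.2 (by omega : m + 1 < K + 1))
      have h6 := le_mul_of_one_le_right (by positivity : (0 : ℝ) ≤ ((4 : ℝ) ^ a) ^ (m + 1)) h3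
      linarith

/-- The step `2^{-k} e_j`. -/
def dyadicStep (k : ℕ) (j : Fin n) : Eucl n := ((2 : ℝ) ^ k)⁻¹ • EuclideanSpace.single j 1

theorem norm_dyadicStep (k : ℕ) (j : Fin n) : ‖dyadicStep k j‖ = ((2 : ℝ) ^ k)⁻¹ := by
  rw [dyadicStep, norm_smul, Real.norm_of_nonneg (by positivity)]
  simp

theorem norm_dyadicStep_le_one (k : ℕ) (j : Fin n) : ‖dyadicStep k j‖ ≤ 1 := by
  rw [norm_dyadicStep]
  exact inv_le_one_of_one_le₀ (one_le_pow₀ (by norm_num))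

theorem charSymbol_dyadicStep (k : ℕ) (j : Fin n) (ξ : Eucl n) :
    charSymbol (dyadicStep k j) ξ =
      Complex.exp (((2 * Real.pi * (ξ j / 2 ^ k) : ℝ) : ℂ) * Complex.I) := by
  rw [charSymbol, dyadicStep, real_inner_smul_left, EuclideanSpace.inner_single_left]
  simp [div_eq_inv_mul]

/-- The weighted sum of the squared `L²` norms of dyadic increments of `f`, over the scales up to
`2^{-K}`. The weights may depend on `K`. -/
def diffEnergy (w : ℕ → ℕ → ℝ) (K : ℕ) (f : L2 n) : ℝ :=
  ∑ k ∈ Finset.range (K + 1), w K k * ∑ j, ‖transL2 (dyadicStep k j) f - f‖ ^ 2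

/-- The symbol which represents `diffEnergy` on the Fourier side. -/
def diffSymbol (w : ℕ → ℕ → ℝ) (K : ℕ) (ξ : Eucl n) : ℝ :=
  ∑ k ∈ Finset.range (K + 1), w K k * ∑ j, ‖charSymbol (dyadicStep k j) ξ - 1‖ ^ 2

theorem diffSymbol_nonneg {w : ℕ → ℕ → ℝ} (hw : ∀ K k, 0 ≤ w K k) (K : ℕ) (ξ : Eucl n) :
    0 ≤ diffSymbol w K ξ :=
  Finset.sum_nonneg fun k _ => mul_nonneg (hw K k) (Finset.sum_nonneg fun j _ => by positivity)

theorem continuous_charSymbol (h : Eucl n) : Continuous (charSymbol h) :=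
  (charSymbol_hasTemperateGrowth h).1.continuous

theorem continuous_diffSymbol (w : ℕ → ℕ → ℝ) (K : ℕ) :
    Continuous (diffSymbol w K : Eucl n → ℝ) := by
  unfold diffSymbol
  have := fun (k : ℕ) (j : Fin n) => continuous_charSymbol (dyadicStep k j)
  fun_prop

theorem ofReal_diffEnergy {w : ℕ → ℕ → ℝ} (hw : ∀ K k, 0 ≤ w K k) (K : ℕ) (f : L2 n) :
    ENNReal.ofReal (diffEnergy w K f) =
      ∫⁻ ξ, ENNReal.ofReal (diffSymbol w K ξ) * ‖(𝓕 f : L2 n) ξ‖ₑ ^ 2 := by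
  have hm : ∀ (k : ℕ) (j : Fin n), AEMeasurable (fun ξ : Eucl n =>
      ENNReal.ofReal (‖charSymbol (dyadicStep k j) ξ - 1‖ ^ 2) * ‖(𝓕 f : L2 n) ξ‖ₑ ^ 2)
      volume := by
    intro k j
    have := continuous_charSymbol (dyadicStep k j)
    refine AEMeasurable.mul ?_ ((Lp.aestronglyMeasurable _).enorm.pow_const 2)
    exact (ENNReal.continuous_ofReal.comp (by fun_prop)).aemeasurable
  have h1 : ∀ k (ξ : Eucl n), 0 ≤ w K k * ∑ j, ‖charSymbol (dyadicStep k j) ξ - 1‖ ^ 2 :=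
    fun k ξ => mul_nonneg (hw K k) (Finset.sum_nonneg fun j _ => by positivity)
  have h2 : ∀ k, 0 ≤ w K k * ∑ j, ‖transL2 (dyadicStep k j) f - f‖ ^ 2 :=
    fun k => mul_nonneg (hw K k) (Finset.sum_nonneg fun j _ => by positivity)
  simp only [diffEnergy, diffSymbol]
  rw [ENNReal.ofReal_sum_of_nonneg fun k _ => h2 k]
  simp_rw [ENNReal.ofReal_sum_of_nonneg fun k _ => h1 k _, Finset.sum_mul]
  rw [lintegral_finsetSum' _ fun k _ => ?_]
  · refine Finset.sum_congr rfl fun k _ => ?_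
    simp_rw [ENNReal.ofReal_mul (hw K k), mul_assoc]
    rw [lintegral_const_mul' _ _ ENNReal.ofReal_ne_top]
    congr 1
    rw [ENNReal.ofReal_sum_of_nonneg fun j _ => by positivity]
    simp_rw [ENNReal.ofReal_sum_of_nonneg fun (j : Fin n) (_ : j ∈ Finset.univ) =>
      sq_nonneg ‖charSymbol (dyadicStep k j) _ - 1‖, Finset.sum_mul]
    rw [lintegral_finsetSum' _ fun j _ => hm k j]
    refine Finset.sum_congr rfl fun j _ => ?_
    rw [← enorm_transL2_sub_sq, ENNReal.ofReal_pow (norm_nonneg _), ofReal_norm]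
  · refine AEMeasurable.mul ?_ ((Lp.aestronglyMeasurable _).enorm.pow_const 2)
    have := fun (j : Fin n) => continuous_charSymbol (dyadicStep k j)
    exact (ENNReal.continuous_ofReal.comp (by fun_prop)).aemeasurable

/-- Weights as in `exists_scale_weights`: the energies they define are bounded by the Sobolev norm
and control it. -/
structure IsSobolevWeight (n : ℕ) (a : ℝ) (w : ℕ → ℕ → ℝ) (C : ℝ) : Prop where
  pos : 0 < C
  nonneg : ∀ K k, 0 ≤ w K k
  sum_le : ∀ K, ∑ k ∈ Finset.range (K + 1), w K k * (((2 : ℝ) ^ k)⁻¹) ^ 2 ≤ C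
  symbol_le : ∀ K (ξ : Eucl n), diffSymbol w K ξ ≤ C * (1 + ‖ξ‖ ^ 2) ^ a
  le_symbol : ∀ ξ : Eucl n, ∀ᶠ K in atTop, (1 + ‖ξ‖ ^ 2) ^ a ≤ C * (1 + diffSymbol w K ξ)

theorem one_add_sum_rpow_le {a : ℝ} (ha0 : 0 ≤ a) (ha1 : a ≤ 1) {ι : Type*} (s : Finset ι)
    {x : ι → ℝ} (hx : ∀ i, 0 ≤ x i) : (1 + ∑ i ∈ s, x i) ^ a ≤ 1 + ∑ i ∈ s, x i ^ a := by
  classical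
  induction s using Finset.induction_on with
  | empty => simp
  | insert i s hi ih =>
    rw [Finset.sum_insert hi, Finset.sum_insert hi, add_left_comm, add_left_comm (1 : ℝ)]
    have h := Real.rpow_add_le_add_rpow (hx i)
      (by linarith [Finset.sum_nonneg fun i (_ : i ∈ s) => hx i] : 0 ≤ 1 + ∑ i ∈ s, x i) ha0 ha1
    linarith

theorem exists_isSobolevWeight (n : ℕ) {a : ℝ} (ha0 : 0 ≤ a) (ha1 : a ≤ 1) :
    ∃ w C, IsSobolevWeight n a w C := by
  obtain ⟨w, C, hC, hw, hup, hlow⟩ := exists_scale_weights ha0 ha1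
  have hD : C ≤ (40 * n + 1) * C + (n + 1) := by
    nlinarith [mul_nonneg (Nat.cast_nonneg (α := ℝ) n) hC.le, Nat.cast_nonneg (α := ℝ) n]
  refine ⟨w, (40 * n + 1) * C + (n + 1), by positivity, hw, fun K => ?_, fun K ξ => ?_, fun ξ => ?_⟩
  · refine le_trans ?_ hD
    have h := hup K 1 le_rfl
    rw [Real.one_rpow, mul_one] at h
    refine le_trans (le_of_eq ?_) h
    refine Finset.sum_congr rfl fun k _ => ?_
    rw [inv_pow, ← pow_mul, mul_comm k 2, pow_mul, min_eq_right]
    · norm_num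
    · exact div_le_one_of_le₀ (one_le_pow₀ (by norm_num)) (by positivity)
  · have h1 : ∀ k, ∑ j, ‖charSymbol (dyadicStep k j) ξ - 1‖ ^ 2 ≤
        (40 * n) * min 1 ((1 + ‖ξ‖ ^ 2) / 4 ^ k) := by
      intro k
      calc _ ≤ ∑ j : Fin n, 40 * min 1 ((1 + ‖ξ‖ ^ 2) / 4 ^ k) := by
            refine Finset.sum_le_sum fun j _ => ?_
            rw [charSymbol_dyadicStep]
            refine (norm_exp_sub_one_sq_le _).trans ?_
            have h2 : |ξ j| ≤ ‖ξ‖ := PiLp.norm_apply_le ξ j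
            have h3 : (ξ j) ^ 2 ≤ ‖ξ‖ ^ 2 := by rw [← sq_abs]; gcongr
            rw [div_pow, ← pow_mul, mul_comm k 2, pow_mul, show (2 : ℝ) ^ 2 = 4 by norm_num]
            gcongr
            linarith
        _ = _ := by simp; ring
    calc diffSymbol w K ξ ≤ ∑ k ∈ Finset.range (K + 1),
          w K k * ((40 * n) * min 1 ((1 + ‖ξ‖ ^ 2) / 4 ^ k)) :=
          Finset.sum_le_sum fun k _ => mul_le_mul_of_nonneg_left (h1 k) (hw K k)
      _ = (40 * n) * ∑ k ∈ Finset.range (K + 1), w K k * min 1 ((1 + ‖ξ‖ ^ 2) / 4 ^ k) := by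
          rw [Finset.mul_sum]
          exact Finset.sum_congr rfl fun k _ => by ring
      _ ≤ (40 * n) * (C * (1 + ‖ξ‖ ^ 2) ^ a) := by
          gcongr
          exact hup K _ (by simp)
      _ ≤ _ := by
          rw [← mul_assoc]
          gcongr
          nlinarith [Nat.cast_nonneg (α := ℝ) n]
  · filter_upwards [eventually_all.2 fun j => hlow (ξ j)] with K hK
    have h1 : (1 + ‖ξ‖ ^ 2) ^ a ≤ 1 + ∑ j, ((ξ j) ^ 2) ^ a := by
      rw [EuclideanSpace.real_norm_sq_eq]
      exact one_add_sum_rpow_le ha0 ha1 _ fun j => sq_nonneg (ξ j)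
    have h2 : ∑ j, ((ξ j) ^ 2) ^ a ≤ n + diffSymbol w K ξ := by
      calc _ ≤ ∑ j : Fin n, (1 + ∑ k ∈ Finset.range (K + 1), w K k *
            ‖charSymbol (dyadicStep k j) ξ - 1‖ ^ 2) := by
            refine Finset.sum_le_sum fun j _ => ?_
            simp_rw [charSymbol_dyadicStep]
            exact hK j
        _ = _ := by
            rw [Finset.sum_add_distrib, Finset.sum_comm, diffSymbol]
            simp [Finset.mul_sum]
    have h3 : 0 ≤ diffSymbol w K ξ := diffSymbol_nonneg hw K ξ
    have h4 : (1 : ℝ) ≤ (40 * n + 1) * C + (n + 1) := by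
      have : 0 ≤ (40 * n + 1) * C := by positivity
      have : (0 : ℝ) ≤ n := Nat.cast_nonneg _
      linarith
    have h5 : (n + 1 : ℝ) ≤ (40 * n + 1) * C + (n + 1) := by
      have : 0 ≤ (40 * n + 1) * C := by positivity
      linarith
    nlinarith [mul_le_mul_of_nonneg_right h4 h3]

namespace SobolevSpace

variable {a : ℝ}

/-- The increments of an element of `H^a` are bounded by its norm. -/
theorem diffEnergy_le {w : ℕ → ℕ → ℝ} {C : ℝ} (hw : IsSobolevWeight n a w C) (ha : 0 ≤ a) (K : ℕ)
    (u : SobolevSpace n a) : diffEnergy w K (toL2 ha u) ≤ C * ‖u‖ ^ 2 := by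
  have hC := hw.pos
  rw [← ENNReal.ofReal_le_ofReal_iff (by positivity), ofReal_diffEnergy hw.nonneg,
    ENNReal.ofReal_mul hC.le, ENNReal.ofReal_pow (norm_nonneg _), ofReal_norm,
    enorm_sq_eq_lintegral ha, ← lintegral_const_mul' _ _ ENNReal.ofReal_ne_top]
  refine lintegral_mono fun ξ => ?_
  rw [← mul_assoc, ← ENNReal.ofReal_mul hC.le]
  gcongr
  exact hw.symbol_le K ξ

/-- The converse of `diffEnergy_le`: bounded energies imply membership in `H^a`. As only the limit
of the symbols controls `⟨ξ⟩^{2a}`, the bound comes from Fatou's lemma. -/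
theorem exists_of_diffEnergy_le {w : ℕ → ℕ → ℝ} {C : ℝ} (hw : IsSobolevWeight n a w C)
    (ha : 0 ≤ a) {f : L2 n} {M : ℝ} (hM : 0 ≤ M) (hf : ‖f‖ ≤ M)
    (h : ∀ K, diffEnergy w K f ≤ M ^ 2) :
    ∃ u : SobolevSpace n a, toL2 ha u = f ∧ ‖u‖ ≤ 2 * (C + 1) * M := by
  have hC := hw.pos
  refine exists_of_lintegral_le ha f (by positivity) ?_
  have h1 : ∀ ξ, ENNReal.ofReal ((1 + ‖ξ‖ ^ 2) ^ a) * ‖(𝓕 f : L2 n) ξ‖ₑ ^ 2 ≤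
      liminf (fun K => ENNReal.ofReal (C * (1 + diffSymbol w K ξ)) * ‖(𝓕 f : L2 n) ξ‖ₑ ^ 2)
        atTop := by
    intro ξ
    refine le_liminf_of_le (by isBoundedDefault) ?_
    filter_upwards [hw.le_symbol ξ] with K hK
    gcongr
  refine (lintegral_mono h1).trans ((lintegral_liminf_le' fun K => ?_).trans ?_)
  · refine AEMeasurable.mul ?_ ((Lp.aestronglyMeasurable _).enorm.pow_const 2)
    have := continuous_diffSymbol (n := n) w K
    exact (ENNReal.continuous_ofReal.comp (by fun_prop)).aemeasurable
  refine liminf_le_of_le (by isBoundedDefault) fun b hb => ?_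
  obtain ⟨K, hK⟩ := hb.exists
  refine hK.trans ?_
  have h2 : ∀ ξ, ENNReal.ofReal (C * (1 + diffSymbol w K ξ)) * ‖(𝓕 f : L2 n) ξ‖ₑ ^ 2 =
      ENNReal.ofReal C * (‖(𝓕 f : L2 n) ξ‖ₑ ^ 2 +
        ENNReal.ofReal (diffSymbol w K ξ) * ‖(𝓕 f : L2 n) ξ‖ₑ ^ 2) := by
    intro ξ
    rw [ENNReal.ofReal_mul hC.le, ENNReal.ofReal_add zero_le_one (diffSymbol_nonneg hw.nonneg K ξ),
      ENNReal.ofReal_one]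
    ring
  simp_rw [h2]
  rw [lintegral_const_mul' _ _ ENNReal.ofReal_ne_top,
    lintegral_add_left' ((Lp.aestronglyMeasurable _).enorm.pow_const 2),
    ← _root_.enorm_sq_eq_lintegral, enorm_fourier_eq, ← ofReal_diffEnergy hw.nonneg, ← ofReal_norm,
    ← ENNReal.ofReal_pow (norm_nonneg _), ← ENNReal.ofReal_pow (by positivity)]
  have h3 : 0 ≤ diffEnergy w K f :=
    Finset.sum_nonneg fun k _ => mul_nonneg (hw.nonneg K k)
      (Finset.sum_nonneg fun j _ => by positivity)
  rw [← ENNReal.ofReal_add (by positivity) h3, ← ENNReal.ofReal_mul hC.le]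
  refine ENNReal.ofReal_le_ofReal ?_
  have h4 : ‖f‖ ^ 2 ≤ M ^ 2 := by gcongr
  have h5 := h K
  calc C * (‖f‖ ^ 2 + diffEnergy w K f) ≤ C * (M ^ 2 + M ^ 2) := by gcongr
    _ ≤ (2 * (C + 1) * M) ^ 2 := by
      nlinarith [sq_nonneg M, mul_nonneg hC.le (sq_nonneg M),
        mul_nonneg (mul_nonneg hC.le hC.le) (sq_nonneg M)]

theorem add_add_sq_le (x y z : ℝ) : (x + y + z) ^ 2 ≤ 3 * (x ^ 2 + y ^ 2 + z ^ 2) := by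
  nlinarith [sq_nonneg (x - y), sq_nonneg (y - z), sq_nonneg (x - z)]

/-- A square integrable function belongs to `H^a` when its increments are dominated by those of
elements of `H^a` and of a Lipschitz function. -/
theorem exists_of_increments_le (n : ℕ) {a : ℝ} (ha0 : 0 ≤ a) (ha1 : a ≤ 1) :
    ∃ D : ℝ, 0 < D ∧ ∀ (f : L2 n) (u₁ u₂ : SobolevSpace n a) (p q₁ q₂ M : ℝ), 0 ≤ p → 0 ≤ q₁ →
      0 ≤ q₂ → ‖f‖ ≤ M → p ≤ M → q₁ * ‖u₁‖ ≤ M → q₂ * ‖u₂‖ ≤ M →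
      (∀ h : Eucl n, ‖h‖ ≤ 1 → ‖transL2 h f - f‖ ≤ p * ‖h‖ +
        q₁ * ‖transL2 h (toL2 ha0 u₁) - toL2 ha0 u₁‖ +
        q₂ * ‖transL2 h (toL2 ha0 u₂) - toL2 ha0 u₂‖) →
      ∃ u : SobolevSpace n a, toL2 ha0 u = f ∧ ‖u‖ ≤ D * M := by
  obtain ⟨w, C, hw⟩ := exists_isSobolevWeight n ha0 ha1
  have hC := hw.pos
  set B : ℝ := 3 * ((n + 2) * C) with hB
  have hBpos : 0 < B := by positivity
  refine ⟨2 * (C + 1) * (1 + B), by positivity, fun f u₁ u₂ p q₁ q₂ M hp hq₁ hq₂ hf hpM hu₁ hu₂ hT =>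
    ?_⟩
  have hM : 0 ≤ M := (norm_nonneg f).trans hf
  rw [mul_assoc]
  refine exists_of_diffEnergy_le hw ha0 (by positivity) ?_ fun K => ?_
  · exact hf.trans (le_mul_of_one_le_left hM (by linarith))
  have h1 : ∀ k, w K k * ∑ j : Fin n, ‖transL2 (dyadicStep k j) f - f‖ ^ 2 ≤
      3 * p ^ 2 * n * (w K k * (((2 : ℝ) ^ k)⁻¹) ^ 2) + 3 * q₁ ^ 2 * (w K k * ∑ j : Fin n,
        ‖transL2 (dyadicStep k j) (toL2 ha0 u₁) - toL2 ha0 u₁‖ ^ 2) + 3 * q₂ ^ 2 *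
        (w K k * ∑ j : Fin n, ‖transL2 (dyadicStep k j) (toL2 ha0 u₂) - toL2 ha0 u₂‖ ^ 2) := by
    intro k
    have h2 : ∀ j : Fin n, ‖transL2 (dyadicStep k j) f - f‖ ^ 2 ≤
        3 * p ^ 2 * (((2 : ℝ) ^ k)⁻¹) ^ 2 +
        3 * q₁ ^ 2 * ‖transL2 (dyadicStep k j) (toL2 ha0 u₁) - toL2 ha0 u₁‖ ^ 2 +
        3 * q₂ ^ 2 * ‖transL2 (dyadicStep k j) (toL2 ha0 u₂) - toL2 ha0 u₂‖ ^ 2 := by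
      intro j
      have h3 := hT (dyadicStep k j) (norm_dyadicStep_le_one k j)
      rw [norm_dyadicStep] at h3
      have h4 := pow_le_pow_left₀ (norm_nonneg _) h3 2
      refine h4.trans ?_
      refine (add_add_sq_le _ _ _).trans (le_of_eq ?_)
      ring
    have h5 := mul_le_mul_of_nonneg_left (Finset.sum_le_sum fun j (_ : j ∈ Finset.univ) => h2 j)
      (hw.nonneg K k)
    refine h5.trans (le_of_eq ?_)
    simp only [Finset.sum_add_distrib, ← Finset.mul_sum, Finset.sum_const, Finset.card_univ,
      Fintype.card_fin, nsmul_eq_mul]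
    ring
  have h6 : diffEnergy w K f ≤ 3 * p ^ 2 * n * C + 3 * q₁ ^ 2 * (C * ‖u₁‖ ^ 2) +
      3 * q₂ ^ 2 * (C * ‖u₂‖ ^ 2) := by
    refine (Finset.sum_le_sum fun k _ => h1 k).trans ?_
    simp only [Finset.sum_add_distrib, ← Finset.mul_sum]
    gcongr
    · exact hw.sum_le K
    · exact diffEnergy_le hw ha0 K u₁
    · exact diffEnergy_le hw ha0 K u₂
  refine h6.trans ?_
  have e1 : p ^ 2 ≤ M ^ 2 := by gcongr
  have e2 : q₁ ^ 2 * ‖u₁‖ ^ 2 ≤ M ^ 2 := by rw [← mul_pow]; gcongr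
  have e3 : q₂ ^ 2 * ‖u₂‖ ^ 2 ≤ M ^ 2 := by rw [← mul_pow]; gcongr
  calc _ = 3 * (n * C) * p ^ 2 + 3 * C * (q₁ ^ 2 * ‖u₁‖ ^ 2) + 3 * C * (q₂ ^ 2 * ‖u₂‖ ^ 2) := by
        ring
    _ ≤ 3 * (n * C) * M ^ 2 + 3 * C * M ^ 2 + 3 * C * M ^ 2 := by gcongr
    _ = B * M ^ 2 := by rw [hB]; ring
    _ ≤ ((1 + B) * M) ^ 2 := by
        rw [mul_pow]
        gcongr
        nlinarith

end SobolevSpace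

/-! ### Multiplication by bounded Lipschitz functions -/

theorem exists_L2_mul {m : Eucl n → ℂ} (hm : AEStronglyMeasurable m volume) {C : ℝ}
    (hC : ∀ x, ‖m x‖ ≤ C) (f : L2 n) :
    ∃ g : L2 n, (g =ᵐ[volume] fun x => m x * f x) ∧ ‖g‖ ≤ C * ‖f‖ := by
  have h : MemLp m ∞ volume := memLp_top_of_bound hm C (Eventually.of_forall hC)
  have hg : (h.toLp m • f : L2 n) =ᵐ[volume] fun x => m x * f x := by
    filter_upwards [Lp.coeFn_lpSMul (r := 2) (h.toLp m) f, h.coeFn_toLp] with x h1 h2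
    rw [h1]
    simp [h2]
  refine ⟨_, hg, Lp.norm_le_mul_norm_of_ae_le_mul ?_⟩
  filter_upwards [hg] with x hx
  rw [hx, norm_mul]
  gcongr
  exact hC x

theorem ae_comp_add_const {p : Eucl n → Prop} (hp : ∀ᵐ x, p x) (h : Eucl n) :
    ∀ᵐ x : Eucl n, p (x + h) :=
  (measurePreserving_add_const h).quasiMeasurePreserving.ae hp

/-- The increments of a product of a Lipschitz function and a square integrable function. -/
theorem norm_transL2_sub_mul_le {m : Eucl n → ℂ} (hm : Continuous m) {B L : ℝ}
    (hB : ∀ x, ‖m x‖ ≤ B) (hL : ∀ x h, ‖m (x + h) - m x‖ ≤ L * ‖h‖) {f g : L2 n}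
    (hg : g =ᵐ[volume] fun x => m x * f x) (h : Eucl n) :
    ‖transL2 h g - g‖ ≤ L * ‖f‖ * ‖h‖ + B * ‖transL2 h f - f‖ := by
  obtain ⟨k₁, hk₁, hn₁⟩ := exists_L2_mul (m := fun x => m (x + h) - m x)
    (by fun_prop) (fun x => hL x h) (transL2 h f)
  obtain ⟨k₂, hk₂, hn₂⟩ := exists_L2_mul hm.aestronglyMeasurable hB (transL2 h f - f)
  have h1 : transL2 h g - g = k₁ + k₂ := by
    refine Lp.ext ?_
    filter_upwards [Lp.coeFn_sub (transL2 h g) g, Lp.coeFn_add k₁ k₂, hk₁, hk₂, hg,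
      ae_comp_add_const hg h, coeFn_transL2 h g, coeFn_transL2 h f, Lp.coeFn_sub (transL2 h f) f]
      with x e1 e2 e3 e4 e5 e6 e7 e8 e9
    rw [e1, e2, Pi.sub_apply, Pi.add_apply, e3, e4, e5, e7, e6, e9, Pi.sub_apply, e8]
    ring
  rw [h1]
  refine (norm_add_le _ _).trans (add_le_add (hn₁.trans (le_of_eq ?_)) hn₂)
  rw [LinearIsometry.norm_map]
  ring

namespace SobolevSpace

variable {a : ℝ}

/-- Multiplication by a smooth bounded Lipschitz function is bounded on `H^a`, `0 ≤ a ≤ 1`. -/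
theorem exists_smulLeft (n : ℕ) {a : ℝ} (ha0 : 0 ≤ a) (ha1 : a ≤ 1) :
    ∃ D : ℝ, 0 < D ∧ ∀ (m : Eucl n → ℂ), m.HasTemperateGrowth → ∀ B L : ℝ, 0 ≤ B → 0 ≤ L →
      (∀ x, ‖m x‖ ≤ B) → (∀ x h, ‖m (x + h) - m x‖ ≤ L * ‖h‖) → ∀ u : SobolevSpace n a,
      ∃ v : SobolevSpace n a, toDistr v = TemperedDistribution.smulLeftCLM ℂ m (toDistr u) ∧
        ‖v‖ ≤ D * (B + L) * ‖u‖ := by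
  obtain ⟨D, hD, h⟩ := exists_of_increments_le n ha0 ha1
  refine ⟨D, hD, fun m hm B L hB0 hL0 hB hL u => ?_⟩
  obtain ⟨g, hg, hg'⟩ := exists_L2_smul hm hB (toL2 ha0 u)
  have hu := norm_toL2_le ha0 u
  have hgn : ‖g‖ ≤ B * ‖toL2 ha0 u‖ := by
    refine Lp.norm_le_mul_norm_of_ae_le_mul ?_
    filter_upwards [hg'] with x hx
    rw [hx, norm_mul]
    gcongr
    exact hB x
  obtain ⟨v, hv, hvn⟩ := h g u 0 (L * ‖toL2 ha0 u‖) B 0 ((B + L) * ‖u‖) (by positivity) hB0 le_rfl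
    (hgn.trans (by gcongr; linarith)) (by gcongr; linarith) (by gcongr; linarith)
    (by simp; positivity) fun h _ => by
      have := norm_transL2_sub_mul_le hm.1.continuous hB hL hg' h
      simpa using this
  refine ⟨v, ?_, by rwa [mul_assoc]⟩
  rw [toL2_spec ha0 v, hv, hg, ← toL2_spec]

end SobolevSpace

/-! ### Smooth cutoffs -/

/-- The function `1 - F(|x|/R)`, the symbol of `F_c(|x| / R ≤ 1)`. -/
def ballCutoff (n : ℕ) (F : ℝ → ℝ) (R : ℝ) (x : Eucl n) : ℂ := ((1 - F (‖x‖ / R) : ℝ) : ℂ)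

theorem norm_ballCutoff_sub_le {F : ℝ → ℝ} {L : ℝ} (hL : ∀ k l, |F k - F l| ≤ L * |k - l|)
    (hL0 : 0 ≤ L) {R : ℝ} (hR : 0 < R) (x h : Eucl n) :
    ‖ballCutoff n F R (x + h) - ballCutoff n F R x‖ ≤ L / R * ‖h‖ := by
  rw [ballCutoff, ballCutoff, ← Complex.ofReal_sub, Complex.norm_real, Real.norm_eq_abs,
    sub_sub_sub_cancel_left, abs_sub_comm]
  refine (hL _ _).trans ?_
  rw [← sub_div, abs_div, abs_of_pos hR, div_mul_eq_mul_div, mul_div_assoc]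
  gcongr
  have := abs_norm_sub_norm_le (x + h) x
  rwa [add_sub_cancel_left] at this

namespace IsSmoothCutoff

variable {F : ℝ → ℝ}

theorem exists_bound (hF : IsSmoothCutoff F) : ∃ B : ℝ, 0 ≤ B ∧ ∀ k, |1 - F k| ≤ B := by
  obtain ⟨B, hB⟩ := (isCompact_Icc (a := (1 / 2 : ℝ)) (b := 1)).exists_bound_of_continuousOn
    (f := fun k => 1 - F k) (by have := hF.smooth.continuous; fun_prop)
  refine ⟨max B 1, by positivity, fun k => ?_⟩
  rcases le_or_gt k (1 / 2) with h | h
  · rw [hF.eq_zero k h]; simp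
  rcases le_or_gt 1 k with h' | h'
  · rw [hF.eq_one k h']; simp
  · exact (hB k ⟨h.le, h'.le⟩).trans (le_max_left _ _)

theorem exists_lipschitz (hF : IsSmoothCutoff F) :
    ∃ L : ℝ, 0 ≤ L ∧ ∀ k l, |F k - F l| ≤ L * |k - l| := by
  have hc : Continuous (deriv F) := hF.smooth.continuous_deriv (by simp)
  obtain ⟨L, hL⟩ := (isCompact_Icc (a := (1 / 2 : ℝ)) (b := 1)).exists_bound_of_continuousOn
    hc.continuousOn
  have hL' : ∀ k, ‖deriv F k‖ ≤ max L 0 := by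
    intro k
    rcases lt_or_ge k (1 / 2) with h | h
    · have : F =ᶠ[𝓝 k] fun _ => 0 := by
        filter_upwards [Iio_mem_nhds h] with l hl using hF.eq_zero l (le_of_lt hl)
      rw [this.deriv_eq]; simp
    rcases lt_or_ge 1 k with h' | h'
    · have : F =ᶠ[𝓝 k] fun _ => 1 := by
        filter_upwards [Ioi_mem_nhds h'] with l hl using hF.eq_one l (le_of_lt hl)
      rw [this.deriv_eq]; simp
    · exact (hL k ⟨h, h'⟩).trans (le_max_left _ _)
  refine ⟨max L 0, le_max_right _ _, fun k l => ?_⟩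
  exact Convex.norm_image_sub_le_of_norm_deriv_le (s := Set.univ) (fun x _ =>
    (hF.smooth.differentiable (by simp)).differentiableAt) (fun x _ => hL' x) convex_univ
    (Set.mem_univ _) (Set.mem_univ _)

theorem ballCutoff_hasTemperateGrowth (hF : IsSmoothCutoff F) (n : ℕ) {R : ℝ} (hR : 0 < R) :
    (ballCutoff n F R).HasTemperateGrowth := by
  have h := (Function.HasTemperateGrowth.const (1 : ℂ)).sub (hF.hasTemperateGrowth n hR)
  convert h using 1
  funext x
  simp [ballCutoff]

theorem ballCutoff_eq_zero (hF : IsSmoothCutoff F) {R : ℝ} (hR : 0 < R) {x : Eucl n}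
    (hx : R ≤ ‖x‖) :
    ballCutoff n F R x = 0 := by
  rw [ballCutoff, hF.eq_one _ ((one_le_div hR).2 hx)]
  simp

theorem ballCutoff_eq_one (hF : IsSmoothCutoff F) {R : ℝ} (hR : 0 < R) {x : Eucl n}
    (hx : 2 * ‖x‖ ≤ R) :
    ballCutoff n F R x = 1 := by
  rw [ballCutoff, hF.eq_zero _ (by rw [div_le_iff₀ hR]; linarith)]
  simp

/-- The cutoffs of a Schwartz function converge to it in `L²`: the error is `O(R^{-2})`, since `χ`
decays faster than `|x|^{-2}` in `L²`. -/
theorem tendsto_embL2_ballCutoff (hF : IsSmoothCutoff F) (χ : 𝓢(Eucl n, ℂ)) :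
    Tendsto (fun R => embL2 n (SchwartzMap.smulLeftCLM ℂ (ballCutoff n F R) χ)) atTop
      (𝓝 (embL2 n χ)) := by
  obtain ⟨B, hB0, hB⟩ := hF.exists_bound
  have hsq : (fun x : Eucl n => ((‖x‖ ^ 2 : ℝ) : ℂ)).HasTemperateGrowth := by fun_prop
  set κ := SchwartzMap.smulLeftCLM ℂ (fun x : Eucl n => ((‖x‖ ^ 2 : ℝ) : ℂ)) χ with hκ
  rw [tendsto_iff_norm_sub_tendsto_zero]
  have hlim : Tendsto (fun R : ℝ => 4 * (B + 1) * ‖embL2 n κ‖ * (R ^ 2)⁻¹) atTop (𝓝 0) := by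
    have := (tendsto_inv_atTop_zero.comp (tendsto_pow_atTop (α := ℝ) (n := 2) (by norm_num)))
    simpa using this.const_mul (4 * (B + 1) * ‖embL2 n κ‖)
  refine squeeze_zero' (Eventually.of_forall fun _ => norm_nonneg _) ?_ hlim
  filter_upwards [eventually_gt_atTop 0] with R hR
  rw [← map_sub]
  refine (norm_embL2_le_of_forall_le (κ := κ) (C := 4 * (B + 1) * (R ^ 2)⁻¹) fun x => ?_).trans
    (le_of_eq (by ring))
  rw [_root_.sub_apply, SchwartzMap.smulLeftCLM_apply_apply
    (hF.ballCutoff_hasTemperateGrowth n hR), hκ, SchwartzMap.smulLeftCLM_apply_apply hsq,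
    smul_eq_mul, smul_eq_mul, ← sub_one_mul, norm_mul, norm_mul, ← mul_assoc, Complex.norm_real,
    Real.norm_of_nonneg (by positivity)]
  refine mul_le_mul_of_nonneg_right ?_ (norm_nonneg _)
  rcases le_or_gt (2 * ‖x‖) R with h | h
  · rw [hF.ballCutoff_eq_one hR h]
    simp
    positivity
  · have h1 : ‖ballCutoff n F R x - 1‖ ≤ B + 1 := by
      refine (norm_sub_le _ _).trans ?_
      rw [ballCutoff, Complex.norm_real, norm_one, Real.norm_eq_abs]
      linarith [hB (‖x‖ / R)]
    refine h1.trans ?_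
    have h2 : R ^ 2 ≤ 4 * ‖x‖ ^ 2 := by nlinarith
    rw [show 4 * (B + 1) * (R ^ 2)⁻¹ * ‖x‖ ^ 2 = (B + 1) * ((4 * ‖x‖ ^ 2) / R ^ 2) by ring]
    refine le_mul_of_one_le_right (by linarith) ?_
    rwa [one_le_div (by positivity)]

end IsSmoothCutoff

/-! ### Strong convergence of cutoffs -/

/-- Uniformly bounded operators which converge weakly to the identity converge strongly, provided
that each range is fixed by the later operators: `u` is a weak limit of the vectors `T R u`, which
lie in the closed subspace of the vectors with strong convergence. -/
theorem tendsto_of_tendsto_weakly_of_eventually_fixed {E : Type*} [NormedAddCommGroup E]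
    [NormedSpace ℂ E] {T : ℝ → E →L[ℂ] E} {C : ℝ} (hT : ∀ᶠ R in atTop, ‖T R‖ ≤ C) {u : E}
    (hfix : ∀ᶠ R' in atTop, ∀ᶠ R in atTop, T R (T R' u) = T R' u)
    (hweak : ∀ l : StrongDual ℂ E, Tendsto (fun R => l (T R u)) atTop (𝓝 (l u))) :
    Tendsto (fun R => T R u) atTop (𝓝 u) := by
  let S : Submodule ℂ E :=
    { carrier := {v | Tendsto (fun R => T R v) atTop (𝓝 v)}
      add_mem' := fun {v w} hv hw => by
        simp only [Set.mem_ofPred_eq, map_add]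
        exact Tendsto.add hv hw
      zero_mem' := by simp
      smul_mem' := fun c v hv => by
        simp only [Set.mem_ofPred_eq, map_smul]
        exact Tendsto.const_smul hv c }
  have hC : 0 ≤ C := by
    obtain ⟨R, hR⟩ := hT.exists
    exact (norm_nonneg _).trans hR
  have hS : IsClosed (S : Set E) := by
    refine isClosed_of_closure_subset fun v hv => ?_
    change Tendsto (fun R => T R v) atTop (𝓝 v)
    rw [Metric.tendsto_nhds]
    intro ε hε
    obtain ⟨w, hw, hvw⟩ := Metric.mem_closure_iff.1 hv (ε / (2 * (C + 1))) (by positivity)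
    filter_upwards [hT, Metric.tendsto_nhds.1 hw (ε / 2) (by positivity)] with R h1 h2
    rw [dist_eq_norm] at *
    have h3 : T R v - v = (T R (v - w) - (v - w)) + (T R w - w) := by
      rw [map_sub]; abel
    have h4 : ‖T R (v - w)‖ ≤ C * ‖v - w‖ := (T R).le_of_opNorm_le h1 _
    have h5 : (C + 1) * ‖v - w‖ ≤ ε / 2 := by
      calc (C + 1) * ‖v - w‖ ≤ (C + 1) * (ε / (2 * (C + 1))) := by gcongr
        _ = ε / 2 := by field_simp
    rw [h3]
    calc _ ≤ ‖T R (v - w)‖ + ‖v - w‖ + ‖T R w - w‖ :=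
          (norm_add_le _ _).trans (by gcongr; exact norm_sub_le _ _)
      _ < ε := by linarith
  -- a functional which separates `u` from `S` contradicts the weak convergence
  by_contra hu
  have hu' : u ∉ (S : Set E) := hu
  obtain ⟨l, c, hl, hlu⟩ := RCLike.geometric_hahn_banach_closed_point (𝕜 := ℂ)
    (S.restrictScalars ℝ).convex hS hu'
  have h1 : Tendsto (fun R => RCLike.re (l (T R u))) atTop (𝓝 (RCLike.re (l u))) :=
    (RCLike.continuous_re.tendsto _).comp (hweak l)
  refine absurd (le_of_tendsto h1 ?_) (not_le.2 hlu)
  filter_upwards [hfix] with R' hR'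
  refine (hl _ ?_).le
  change Tendsto (fun R => T R (T R' u)) atTop (𝓝 (T R' u))
  exact tendsto_const_nhds.congr' (hR'.mono fun R hR => hR.symm)

namespace SobolevSpace

variable {a : ℝ}

/-- The multiplication operators by cutoff functions as operators on `H^a`. -/
theorem exists_cutoffCLM (n : ℕ) {a : ℝ} (ha0 : 0 ≤ a) (ha1 : a ≤ 1) {F : ℝ → ℝ}
    (hF : IsSmoothCutoff F) :
    ∃ (T : ℝ → SobolevSpace n a →L[ℂ] SobolevSpace n a) (C : ℝ),
      (∀ R > 0, ∀ u, toDistr (T R u) =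
        TemperedDistribution.smulLeftCLM ℂ (ballCutoff n F R) (toDistr u)) ∧
      ∀ R ≥ 1, ‖T R‖ ≤ C := by
  obtain ⟨D, hD, h⟩ := exists_smulLeft n ha0 ha1
  obtain ⟨B, hB0, hB⟩ := hF.exists_bound
  obtain ⟨L, hL0, hL⟩ := hF.exists_lipschitz
  have key : ∀ R : ℝ, ∃ T : SobolevSpace n a →L[ℂ] SobolevSpace n a, 0 < R →
      (∀ u, toDistr (T u) = TemperedDistribution.smulLeftCLM ℂ (ballCutoff n F R) (toDistr u)) ∧
        ‖T‖ ≤ D * (B + L / R) := by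
    intro R
    by_cases hR : 0 < R
    · choose v hv hvn using h (ballCutoff n F R) (hF.ballCutoff_hasTemperateGrowth n hR) B (L / R)
        hB0 (by positivity) (fun x => by
          rw [ballCutoff, Complex.norm_real, Real.norm_eq_abs]; exact hB _)
        (norm_ballCutoff_sub_le hL hL0 hR)
      let T₀ : SobolevSpace n a →ₗ[ℂ] SobolevSpace n a :=
        { toFun := v
          map_add' := fun u w => toDistr_injective (by simp only [map_add, hv])
          map_smul' := fun c u => toDistr_injective (by simp only [map_smul, hv, RingHom.id_apply]) }
      refine ⟨T₀.mkContinuous (D * (B + L / R)) hvn, fun _ => ⟨hv, ?_⟩⟩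
      exact LinearMap.mkContinuous_norm_le _ (by positivity) _
    · exact ⟨0, fun h => absurd h hR⟩
  choose T hT using key
  refine ⟨T, D * (B + L), fun R hR => (hT R hR).1, fun R hR => ?_⟩
  refine (hT R (by linarith)).2.trans ?_
  gcongr
  exact div_le_self hL0 hR

/-- The cutoffs of an element of `H^a` converge to it. There is no rate, and for `a > 0` no direct
estimate is needed: the operators converge weakly, and `F_R F_{R'} = F_{R'}` for `R ≥ 2R'`. -/
theorem tendsto_cutoff (ha0 : 0 ≤ a) {F : ℝ → ℝ} (hF : IsSmoothCutoff F)
    {T : ℝ → SobolevSpace n a →L[ℂ] SobolevSpace n a} {C : ℝ}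
    (hT : ∀ R > 0, ∀ u, toDistr (T R u) =
      TemperedDistribution.smulLeftCLM ℂ (ballCutoff n F R) (toDistr u))
    (hC : ∀ R ≥ 1, ‖T R‖ ≤ C) (u : SobolevSpace n a) :
    Tendsto (fun R => T R u) atTop (𝓝 u) := by
  refine tendsto_of_tendsto_weakly_of_eventually_fixed
    ((eventually_ge_atTop 1).mono hC) ?_ fun l => ?_
  · filter_upwards [eventually_gt_atTop 0] with R' hR'
    filter_upwards [eventually_ge_atTop (2 * R')] with R hR
    have hR0 : 0 < R := by linarith
    apply toDistr_injective
    rw [hT R hR0, hT R' hR', TemperedDistribution.smulLeftCLM_smulLeftCLM_apply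
      (hF.ballCutoff_hasTemperateGrowth n hR') (hF.ballCutoff_hasTemperateGrowth n hR0)]
    congr 2
    funext x
    rw [Pi.mul_apply]
    rcases le_or_gt R' ‖x‖ with hx | hx
    · rw [hF.ballCutoff_eq_zero hR' hx, zero_mul]
    · rw [hF.ballCutoff_eq_one hR0 (by linarith), mul_one]
  · refine tendsto_dual_of_tendsto_distr (C := C * ‖u‖) ?_ (fun χ => ?_) l
    · filter_upwards [eventually_ge_atTop 1] with R hR
      exact (T R).le_of_opNorm_le (hC R hR) u
    · have h1 : Tendsto (fun R => bilin n (embL2 n (SchwartzMap.smulLeftCLM ℂ (ballCutoff n F R) χ))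
          (toL2 ha0 u)) atTop (𝓝 (bilin n (embL2 n χ) (toL2 ha0 u))) :=
        (((bilin n).flip (toL2 ha0 u)).continuous.tendsto _).comp (hF.tendsto_embL2_ballCutoff χ)
      rw [toL2_spec ha0 u, toTemperedDistribution_apply_eq_bilin]
      refine h1.congr' ?_
      filter_upwards [eventually_gt_atTop 0] with R hR
      rw [hT R hR, TemperedDistribution.smulLeftCLM_apply_apply, toL2_spec ha0 u,
        toTemperedDistribution_apply_eq_bilin]

end SobolevSpace

/-! ### The dispersive estimate -/

/-- The constant `(4π|t|)^{-n/2}` of the dispersive estimate. -/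
def dispersiveConst (n : ℕ) (t : ℝ) : ℝ := (Real.pi / (|t| * (2 * Real.pi) ^ 2)) ^ (n / 2 : ℝ)

theorem dispersiveConst_nonneg (n : ℕ) (t : ℝ) : 0 ≤ dispersiveConst n t := by
  unfold dispersiveConst
  positivity

/-- The Fourier transform of a complex Gaussian is bounded in terms of `‖b‖` only, not of `Re b`. -/
theorem norm_fourier_gaussian_le {b : ℂ} (hb : 0 < b.re) {c : ℝ} (hc : 0 < c) (hbc : c ≤ ‖b‖)
    (x y : Eucl n) :
    ‖𝓕 (fun ξ : Eucl n => Complex.exp (-b * ‖ξ‖ ^ 2 + 2 * Real.pi * Complex.I * inner ℝ x ξ)) y‖ ≤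
      (Real.pi / c) ^ (n / 2 : ℝ) := by
  rw [fourier_gaussian_innerProductSpace' hb, norm_mul]
  have h1 : ‖((Real.pi : ℂ) / b) ^ ((Module.finrank ℝ (Eucl n) : ℂ) / 2)‖ ≤
      (Real.pi / c) ^ (n / 2 : ℝ) := by
    have : ((Module.finrank ℝ (Eucl n) : ℂ) / 2) = ((n / 2 : ℝ) : ℂ) := by simp
    rw [this, Complex.norm_cpow_real, norm_div, Complex.norm_real,
      Real.norm_of_nonneg Real.pi_pos.le]
    gcongr
  have h2 : ‖Complex.exp (-(Real.pi : ℂ) ^ 2 * ‖x - y‖ ^ 2 / b)‖ ≤ 1 := by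
    rw [Complex.norm_exp]
    refine Real.exp_le_one_iff.2 ?_
    have h3 : (-(Real.pi : ℂ) ^ 2 * ‖x - y‖ ^ 2 / b) =
        ((-(Real.pi ^ 2 * ‖x - y‖ ^ 2) : ℝ) : ℂ) * b⁻¹ := by
      push_cast
      ring
    rw [h3, Complex.re_ofReal_mul, Complex.inv_re]
    have : 0 ≤ Real.pi ^ 2 * ‖x - y‖ ^ 2 * (b.re / Complex.normSq b) :=
      mul_nonneg (by positivity) (div_nonneg hb.le (Complex.normSq_nonneg _))
    linarith
  calc _ ≤ (Real.pi / c) ^ (n / 2 : ℝ) * 1 := by gcongr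
    _ = _ := mul_one _

/-- A regularised form of the dispersive estimate, for a Gaussian multiplier which is integrable. -/
theorem norm_integral_gaussian_mul_fourier_le {b : ℂ} (hb : 0 < b.re) {c : ℝ} (hc : 0 < c)
    (hbc : c ≤ ‖b‖) (χ : 𝓢(Eucl n, ℂ)) (x : Eucl n) :
    ‖∫ ξ : Eucl n, Complex.exp (-b * ‖ξ‖ ^ 2 + 2 * Real.pi * Complex.I * inner ℝ x ξ) * 𝓕 χ ξ‖ ≤
      (Real.pi / c) ^ (n / 2 : ℝ) * ∫ y, ‖χ y‖ := by
  have h1 := VectorFourier.integral_fourierIntegral_smul_eq_flip (L := innerₗ (Eucl n))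
    (μ := volume) (ν := volume) Real.continuous_fourierChar continuous_inner
    (GaussianFourier.integrable_cexp_neg_mul_sq_norm_add hb (2 * Real.pi * Complex.I) x)
    (χ.integrable (μ := volume))
  have h2 : ∫ ξ : Eucl n, Complex.exp (-b * ‖ξ‖ ^ 2 + 2 * Real.pi * Complex.I * inner ℝ x ξ) *
      𝓕 χ ξ = ∫ y, 𝓕 (fun ξ : Eucl n =>
        Complex.exp (-b * ‖ξ‖ ^ 2 + 2 * Real.pi * Complex.I * inner ℝ x ξ)) y * χ y := by
    simpa using! h1.symm
  rw [h2, ← integral_const_mul]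
  refine norm_integral_le_of_norm_le (χ.integrable.norm.const_mul _)
    (Eventually.of_forall fun y => ?_)
  rw [norm_mul]
  gcongr
  exact norm_fourier_gaussian_le hb hc hbc x y

theorem schwartzMult_freeSymbol_apply (t : ℝ) (χ : 𝓢(Eucl n, ℂ)) (x : Eucl n) :
    schwartzMult (freeSymbol n t) χ x =
      ∫ ξ : Eucl n, Complex.exp (-(((t * (2 * Real.pi) ^ 2 : ℝ) : ℂ) * Complex.I) * ‖ξ‖ ^ 2 +
        2 * Real.pi * Complex.I * inner ℝ x ξ) * 𝓕 χ ξ := by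
  rw [schwartzMult_apply, SchwartzMap.fourier_coe, Real.fourier_eq',
    ← integral_neg_eq_self]
  refine integral_congr_ae (Eventually.of_forall fun ξ => ?_)
  simp only
  rw [SchwartzMap.smulLeftCLM_apply_apply (freeSymbol_hasTemperateGrowth n t), smul_eq_mul,
    smul_eq_mul, freeSymbol, SchwartzMap.fourierInv_coe, Real.fourierInv_eq_fourier_neg, neg_neg,
    ← SchwartzMap.fourier_coe, ← mul_assoc, ← Complex.exp_add, inner_neg_left, norm_neg,
    real_inner_comm]
  congr 2
  push_cast
  ring

/-- The dispersive estimate for the free Schrödinger flow: `L¹ → L^∞` with norm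
`(4π|t|)^{-n/2}`. -/
theorem norm_schwartzMult_freeSymbol_le {t : ℝ} (ht : t ≠ 0) (χ : 𝓢(Eucl n, ℂ)) (x : Eucl n) :
    ‖schwartzMult (freeSymbol n t) χ x‖ ≤ dispersiveConst n t * ∫ y, ‖χ y‖ := by
  rw [schwartzMult_freeSymbol_apply]
  set z : ℂ := ((t * (2 * Real.pi) ^ 2 : ℝ) : ℂ) * Complex.I with hz
  -- the oscillating Gaussian is the limit of integrable ones, and the bound is uniform
  have hlim : Tendsto (fun ε : ℝ => ∫ ξ : Eucl n, Complex.exp (-(ε + z) * ‖ξ‖ ^ 2 +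
      2 * Real.pi * Complex.I * inner ℝ x ξ) * 𝓕 χ ξ) (𝓝[>] 0)
      (𝓝 (∫ ξ : Eucl n, Complex.exp (-z * ‖ξ‖ ^ 2 +
        2 * Real.pi * Complex.I * inner ℝ x ξ) * 𝓕 χ ξ)) := by
    refine tendsto_integral_filter_of_dominated_convergence (fun ξ => ‖𝓕 χ ξ‖) ?_ ?_
      (𝓕 χ).integrable.norm ?_
    · refine Eventually.of_forall fun ε => Continuous.aestronglyMeasurable ?_
      have := (𝓕 χ).continuous
      fun_prop
    · filter_upwards [self_mem_nhdsWithin] with ε hε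
      refine Eventually.of_forall fun ξ => ?_
      rw [norm_mul, Complex.norm_exp]
      refine mul_le_of_le_one_left (norm_nonneg _) (Real.exp_le_one_iff.2 ?_)
      have h3 : (-(ε + z) * ‖ξ‖ ^ 2 + 2 * Real.pi * Complex.I * inner ℝ x ξ) =
          ((-(ε * ‖ξ‖ ^ 2) : ℝ) : ℂ) + ((2 * Real.pi * inner ℝ x ξ -
            t * (2 * Real.pi) ^ 2 * ‖ξ‖ ^ 2 : ℝ) : ℂ) * Complex.I := by
        rw [hz]; push_cast; ring
      rw [h3, Complex.add_re, Complex.ofReal_re, Complex.re_ofReal_mul, Complex.I_re]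
      have : 0 < ε := hε
      have : 0 ≤ ε * ‖ξ‖ ^ 2 := by positivity
      linarith
    · refine Eventually.of_forall fun ξ => ?_
      have hc : Continuous fun ε : ℝ => Complex.exp (-(ε + z) * ‖ξ‖ ^ 2 +
        2 * Real.pi * Complex.I * inner ℝ x ξ) * 𝓕 χ ξ := by fun_prop
      have := hc.tendsto 0
      simp only [Complex.ofReal_zero, zero_add] at this
      exact this.mono_left nhdsWithin_le_nhds
  refine le_of_tendsto hlim.norm ?_
  filter_upwards [self_mem_nhdsWithin] with ε hε
  have hre : z.re = 0 := by rw [hz, Complex.re_ofReal_mul, Complex.I_re, mul_zero]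
  refine norm_integral_gaussian_mul_fourier_le ?_ (by positivity) ?_ χ x
  · rw [Complex.add_re, hre, Complex.ofReal_re, add_zero]
    exact hε
  · have h1 := Complex.abs_im_le_norm (ε + z)
    have h2 : (ε + z : ℂ).im = t * (2 * Real.pi) ^ 2 := by
      rw [hz, Complex.add_im, Complex.ofReal_im, Complex.im_ofReal_mul, Complex.I_im]; ring
    rw [h2, abs_mul, abs_of_nonneg (sq_nonneg (2 * Real.pi))] at h1
    exact h1

/-! ### Products of two square integrable functions -/

theorem integral_norm_mul_le (f g : L2 n) : ∫ x, ‖f x * g x‖ ≤ ‖f‖ * ‖g‖ := by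
  have h1 : eLpNorm (fun x => f x * g x) 1 volume ≤ eLpNorm f 2 volume * eLpNorm g 2 volume := by
    have := eLpNorm_smul_le_mul_eLpNorm (p := 2) (q := 2) (r := 1)
      (Lp.aestronglyMeasurable g) (Lp.aestronglyMeasurable f)
    exact this
  have h2 : Integrable (fun x => f x * g x) volume := (Lp.memLp f).integrable_mul (Lp.memLp g)
  rw [integral_norm_eq_lintegral_enorm h2.1, ← eLpNorm_one_eq_lintegral_enorm, Lp.norm_def,
    Lp.norm_def, ← ENNReal.toReal_mul]
  exact ENNReal.toReal_mono (ENNReal.mul_ne_top (Lp.eLpNorm_ne_top f) (Lp.eLpNorm_ne_top g)) h1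

theorem integrable_L2_mul (f g : L2 n) : Integrable (fun x => f x * g x) volume :=
  (Lp.memLp f).integrable_mul (Lp.memLp g)

/-- The product `f g` of two square integrable functions, tested against a Schwartz function. -/
def prodPairing (f g : L2 n) (χ : 𝓢(Eucl n, ℂ)) : ℂ := ∫ x, f x * g x * χ x

theorem integrable_prodPairing (f g : L2 n) (χ : 𝓢(Eucl n, ℂ)) :
    Integrable (fun x => f x * g x * χ x) volume :=
  (integrable_L2_mul f g).mul_bdd (c := SchwartzMap.seminorm ℝ 0 0 χ)
    χ.continuous.aestronglyMeasurable (Eventually.of_forall fun x => χ.norm_le_seminorm ℝ x)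

theorem norm_prodPairing_le (f g : L2 n) {χ : 𝓢(Eucl n, ℂ)} {A : ℝ} (hA : ∀ x, ‖χ x‖ ≤ A) :
    ‖prodPairing f g χ‖ ≤ A * (‖f‖ * ‖g‖) := by
  have hA0 : 0 ≤ A := (norm_nonneg _).trans (hA 0)
  calc ‖prodPairing f g χ‖ ≤ ∫ x, A * ‖f x * g x‖ := by
        refine norm_integral_le_of_norm_le ((integrable_L2_mul f g).norm.const_mul A)
          (Eventually.of_forall fun x => ?_)
        rw [norm_mul, mul_comm]
        gcongr
        exact hA x
    _ ≤ _ := by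
        rw [integral_const_mul]
        gcongr
        exact integral_norm_mul_le f g

theorem prodPairing_comm (f g : L2 n) (χ : 𝓢(Eucl n, ℂ)) :
    prodPairing f g χ = prodPairing g f χ := by
  simp only [prodPairing, mul_comm]

theorem prodPairing_sub_left (f f' g : L2 n) (χ : 𝓢(Eucl n, ℂ)) :
    prodPairing (f - f') g χ = prodPairing f g χ - prodPairing f' g χ := by
  rw [prodPairing, prodPairing, prodPairing, ← integral_sub (integrable_prodPairing _ _ _)
    (integrable_prodPairing _ _ _)]
  refine integral_congr_ae ?_
  filter_upwards [Lp.coeFn_sub f f'] with x hx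
  rw [hx, Pi.sub_apply]
  ring

theorem prodPairing_sub_right (f g g' : L2 n) (χ : 𝓢(Eucl n, ℂ)) :
    prodPairing f (g - g') χ = prodPairing f g χ - prodPairing f g' χ := by
  rw [prodPairing_comm, prodPairing_sub_left, prodPairing_comm g, prodPairing_comm g']

/-- `prodPairing` as a linear functional of the test function. -/
def prodPairingₗ (f g : L2 n) : 𝓢(Eucl n, ℂ) →ₗ[ℂ] ℂ where
  toFun := prodPairing f g
  map_add' χ κ := by
    rw [prodPairing, prodPairing, prodPairing, ← integral_add (integrable_prodPairing _ _ _)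
      (integrable_prodPairing _ _ _)]
    simp only [_root_.add_apply, mul_add]
  map_smul' c χ := by
    rw [prodPairing, prodPairing, RingHom.id_apply, smul_eq_mul, ← integral_const_mul]
    refine integral_congr_ae (Eventually.of_forall fun x => ?_)
    simp only [_root_.smul_apply, smul_eq_mul]
    ring

theorem prodPairing_sub (f g : L2 n) (χ κ : 𝓢(Eucl n, ℂ)) :
    prodPairing f g (χ - κ) = prodPairing f g χ - prodPairing f g κ :=
  map_sub (prodPairingₗ f g) χ κ

theorem prodPairing_transL2 (h : Eucl n) (f g : L2 n) (χ : 𝓢(Eucl n, ℂ)) :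
    prodPairing (transL2 h f) (transL2 h g) χ =
      prodPairing f g (SchwartzMap.compSubConstCLM ℂ h χ) := by
  have h1 : prodPairing (transL2 h f) (transL2 h g) χ =
      ∫ x, f (x + h) * g (x + h) * χ (x + h - h) := by
    refine integral_congr_ae ?_
    filter_upwards [coeFn_transL2 h f, coeFn_transL2 h g] with x h1 h2
    rw [h1, h2, add_sub_cancel_right]
  rw [h1, integral_add_right_eq_self (fun x => f x * g x * χ (x - h)) h]
  rfl

/-- The local decay of the product `f g` under the free flow: the dispersive estimate turns the
`L¹` bound on `f g` into an `L^∞` bound, which the localisation `G` turns into an `L²` bound. -/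
theorem norm_prodPairing_freeSymbol_le {t : ℝ} (ht : t ≠ 0) {G : Eucl n → ℂ}
    (hG : G.HasTemperateGrowth) {G₂ : L2 n} (hG₂ : G₂ =ᵐ[volume] G) (f g : L2 n)
    (χ : 𝓢(Eucl n, ℂ)) :
    ‖prodPairing f g (schwartzMult (freeSymbol n t) (SchwartzMap.smulLeftCLM ℂ G χ))‖ ≤
      dispersiveConst n t * ‖G₂‖ * ‖f‖ * ‖g‖ * ‖embL2 n χ‖ := by
  have h1 : ∫ y, ‖SchwartzMap.smulLeftCLM ℂ G χ y‖ ≤ ‖G₂‖ * ‖embL2 n χ‖ := by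
    refine le_trans (le_of_eq ?_) (integral_norm_mul_le G₂ (embL2 n χ))
    refine integral_congr_ae ?_
    filter_upwards [hG₂, coeFn_embL2 χ] with x e1 e2
    rw [SchwartzMap.smulLeftCLM_apply_apply hG, e1, e2, smul_eq_mul]
  refine (norm_prodPairing_le f g (norm_schwartzMult_freeSymbol_le ht _)).trans ?_
  calc _ ≤ dispersiveConst n t * (‖G₂‖ * ‖embL2 n χ‖) * (‖f‖ * ‖g‖) := by
        gcongr
        exact dispersiveConst_nonneg n t
    _ = _ := by ring

/-! ### Local decay of products in the Sobolev space -/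

/-- A bounded function which is supported in the ball of radius `r` has `L²` norm `O(r^{n/2})`. -/
theorem exists_L2_of_support (n : ℕ) : ∃ c : ℝ, 0 < c ∧ ∀ (G : Eucl n → ℂ) (A r : ℝ), Continuous G →
    0 ≤ A → 0 < r → (∀ x, ‖G x‖ ≤ A) → (∀ x, r ≤ ‖x‖ → G x = 0) →
    ∃ G₂ : L2 n, (G₂ =ᵐ[volume] G) ∧ ‖G₂‖ ≤ A * (c * r ^ (n / 2 : ℝ)) := by
  set v : ℝ := (volume (Metric.ball (0 : Eucl n) 1)).toReal with hv
  refine ⟨Real.sqrt v + 1, by positivity, fun G A r hG hA hr hGA hG0 => ?_⟩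
  have hcs : HasCompactSupport G := by
    refine HasCompactSupport.intro (isCompact_closedBall (0 : Eucl n) r) fun x hx => hG0 x ?_
    have : r < ‖x‖ := by simpa using hx
    exact this.le
  have hmem : MemLp G 2 volume := hG.memLp_of_hasCompactSupport hcs
  refine ⟨hmem.toLp G, hmem.coeFn_toLp, ?_⟩
  have h0 : 0 ≤ A * ((Real.sqrt v + 1) * r ^ (n / 2 : ℝ)) := by positivity
  rw [← ENNReal.ofReal_le_ofReal_iff h0, ofReal_norm]
  refine (ENNReal.pow_le_pow_left_iff (n := 2) (by norm_num)).1 ?_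
  rw [enorm_sq_eq_lintegral]
  calc ∫⁻ x, ‖hmem.toLp G x‖ₑ ^ 2
      ≤ ∫⁻ x, (Metric.ball (0 : Eucl n) r).indicator (fun _ => ENNReal.ofReal A ^ 2) x := by
        refine lintegral_mono_ae ?_
        filter_upwards [hmem.coeFn_toLp] with x hx
        rw [hx]
        by_cases hxr : x ∈ Metric.ball (0 : Eucl n) r
        · rw [Set.indicator_of_mem hxr, ← ofReal_norm]
          gcongr
          exact hGA x
        · rw [Set.indicator_of_notMem hxr, hG0 x (by simpa using hxr)]
          simp
    _ = ENNReal.ofReal A ^ 2 * volume (Metric.ball (0 : Eucl n) r) := by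
        rw [lintegral_indicator_const measurableSet_ball]
    _ = ENNReal.ofReal A ^ 2 * (ENNReal.ofReal (r ^ n) * ENNReal.ofReal v) := by
        rw [Measure.addHaar_ball_of_pos _ _ hr, hv, ENNReal.ofReal_toReal measure_ball_lt_top.ne]
        simp
    _ ≤ _ := by
        rw [← ENNReal.ofReal_pow hA, ← ENNReal.ofReal_mul (by positivity),
          ← ENNReal.ofReal_mul (by positivity), ← ENNReal.ofReal_pow h0]
        refine ENNReal.ofReal_le_ofReal ?_
        have hv0 : 0 ≤ v := ENNReal.toReal_nonneg
        have h2 : (r ^ (n / 2 : ℝ)) ^ 2 = r ^ n := by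
          rw [← Real.rpow_mul_natCast hr.le]
          norm_num
        rw [mul_pow, mul_pow, h2, mul_comm (r ^ n)]
        gcongr
        nlinarith [Real.sq_sqrt hv0, Real.sqrt_nonneg v]

/-- Translating the functional `χ ↦ prodPairing f g (e^{-itH₀} G χ)` amounts to translating `f`, `g`
and `G`, because the free flow commutes with translations. -/
theorem prodPairing_freeSymbol_translate (t : ℝ) {G : Eucl n → ℂ} (hG : G.HasTemperateGrowth)
    (f g : L2 n) (h : Eucl n) (χ : 𝓢(Eucl n, ℂ)) :
    prodPairing f g (schwartzMult (freeSymbol n t)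
        (SchwartzMap.smulLeftCLM ℂ G (SchwartzMap.compSubConstCLM ℂ h χ))) =
      prodPairing (transL2 h f) (transL2 h g) (schwartzMult (freeSymbol n t)
        (SchwartzMap.smulLeftCLM ℂ (fun x => G (x + h)) χ)) := by
  have hadd : (fun x : Eucl n => x + h).HasTemperateGrowth := by fun_prop
  have hGh : (fun x => G (x + h)).HasTemperateGrowth := hG.comp hadd
  have h1 : SchwartzMap.smulLeftCLM ℂ G (SchwartzMap.compSubConstCLM ℂ h χ) =
      SchwartzMap.compSubConstCLM ℂ h (SchwartzMap.smulLeftCLM ℂ (fun x => G (x + h)) χ) := by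
    ext x
    rw [SchwartzMap.smulLeftCLM_apply_apply hG, SchwartzMap.compSubConstCLM_apply,
      SchwartzMap.compSubConstCLM_apply, SchwartzMap.smulLeftCLM_apply_apply hGh, sub_add_cancel]
  rw [prodPairing_transL2, h1, ← schwartzMult_charSymbol, ← schwartzMult_charSymbol,
    schwartzMult_comm (freeSymbol_hasTemperateGrowth n t) (charSymbol_hasTemperateGrowth h)]

/-- The decay in `H^a` of the product of two elements of `H^a` under the free flow, localised to a
ball of radius `R` and tested against `⟨P⟩^a κ`. The localised product is an `L²` function whose
increments are controlled by those of `u`, `v` and the cutoff, so that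
`SobolevSpace.exists_of_increments_le` applies; no product rule in `H^a` is needed. -/
theorem SobolevSpace.exists_norm_prodPairing_freeSymbol_le (n : ℕ) {a : ℝ} (ha0 : 0 ≤ a)
    (ha1 : a ≤ 1) {F : ℝ → ℝ} (hF : IsSmoothCutoff F) :
    ∃ C : ℝ, 0 < C ∧ ∀ (u v : SobolevSpace n a) (t R : ℝ) (κ : 𝓢(Eucl n, ℂ)), t ≠ 0 → 1 ≤ R →
      ‖prodPairing (toL2 ha0 u) (toL2 ha0 v) (schwartzMult (freeSymbol n t)
        (SchwartzMap.smulLeftCLM ℂ (ballCutoff n F R)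
          (schwartzMult (besselSymbol n a) κ)))‖ ≤
        C * (dispersiveConst n t * R ^ (n / 2 : ℝ)) * ‖u‖ * ‖v‖ * ‖embL2 n κ‖ := by
  obtain ⟨D, hD, hinc⟩ := exists_of_increments_le n ha0 ha1
  obtain ⟨B, hB0, hB⟩ := hF.exists_bound
  obtain ⟨L, hL0, hL⟩ := hF.exists_lipschitz
  obtain ⟨c, hc, hsupp⟩ := exists_L2_of_support n
  set K : ℝ := max (B * c) (L * c * 2 ^ (n / 2 : ℝ)) + 1 with hK
  have hK0 : 0 < K := by positivity
  have hKB : B * c ≤ K := (le_max_left _ _).trans (le_add_of_nonneg_right zero_le_one)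
  have hKL : L * c * 2 ^ (n / 2 : ℝ) ≤ K :=
    (le_max_right _ _).trans (le_add_of_nonneg_right zero_le_one)
  refine ⟨D * K, by positivity, fun u v t R κ ht hR => ?_⟩
  have hR0 : 0 < R := by linarith
  set f := toL2 ha0 u with hf
  set g := toL2 ha0 v with hg
  have hfu : ‖f‖ ≤ ‖u‖ := norm_toL2_le ha0 u
  have hgv : ‖g‖ ≤ ‖v‖ := norm_toL2_le ha0 v
  set d := dispersiveConst n t with hd
  have hd0 : 0 ≤ d := dispersiveConst_nonneg n t
  set ρ := R ^ (n / 2 : ℝ) with hρ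
  have hρ0 : 0 ≤ ρ := by positivity
  set G := ballCutoff n F R with hGdef
  have hG : G.HasTemperateGrowth := hF.ballCutoff_hasTemperateGrowth n hR0
  have hGB : ∀ x, ‖G x‖ ≤ B := fun x => by
    rw [hGdef, ballCutoff, Complex.norm_real]
    exact hB _
  obtain ⟨G₂, hG₂, hG₂n⟩ := hsupp G B R hG.1.continuous hB0 hR0 hGB
    (fun x hx => hF.ballCutoff_eq_zero hR0 hx)
  have hbase : ∀ (f' g' : L2 n) (χ : 𝓢(Eucl n, ℂ)), ‖prodPairing f' g'
      (schwartzMult (freeSymbol n t) (SchwartzMap.smulLeftCLM ℂ G χ))‖ ≤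
      d * K * ρ * ‖f'‖ * ‖g'‖ * ‖embL2 n χ‖ := by
    intro f' g' χ
    refine (norm_prodPairing_freeSymbol_le ht hG hG₂ f' g' χ).trans ?_
    have : ‖G₂‖ ≤ K * ρ := hG₂n.trans (by rw [← mul_assoc]; gcongr)
    calc _ ≤ d * (K * ρ) * ‖f'‖ * ‖g'‖ * ‖embL2 n χ‖ := by gcongr
      _ = _ := by ring
  obtain ⟨U, hU, hUχ⟩ := exists_L2_of_bounded_on_schwartz
    (prodPairingₗ f g ∘ₗ (schwartzMult (freeSymbol n t)).toLinearMap ∘ₗ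
      (SchwartzMap.smulLeftCLM ℂ G).toLinearMap)
    (M := d * K * ρ * ‖f‖ * ‖g‖) (by positivity) (hbase f g)
  have hUχ' : ∀ χ, prodPairing f g (schwartzMult (freeSymbol n t)
      (SchwartzMap.smulLeftCLM ℂ G χ)) = bilin n (embL2 n χ) U := hUχ
  obtain ⟨w, hw, hwM⟩ := hinc U u v (d * K * ρ * ‖u‖ * ‖v‖) (d * K * ρ * ‖v‖) (d * K * ρ * ‖u‖)
    (d * K * ρ * ‖u‖ * ‖v‖) (by positivity) (by positivity) (by positivity)
    (hU.trans (by gcongr)) le_rfl (le_of_eq (by ring)) le_rfl fun h hh => by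
      refine norm_le_of_forall_bilin_schwartz_le (by positivity) fun χ => ?_
      have hadd : (fun x : Eucl n => x + h).HasTemperateGrowth := by fun_prop
      have hGh : (fun x => G (x + h)).HasTemperateGrowth := hG.comp hadd
      have hdiff : (fun x => G (x + h) - G x).HasTemperateGrowth := hGh.sub hG
      obtain ⟨E, hE, hEn⟩ := hsupp (fun x => G (x + h) - G x) (L / R * ‖h‖) (2 * R)
        hdiff.1.continuous (by positivity) (by positivity)
        (fun x => norm_ballCutoff_sub_le hL hL0 hR0 x h) (fun x hx => by
          have h1 : R ≤ ‖x + h‖ := by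
            have := norm_sub_le (x + h) h
            rw [add_sub_cancel_right] at this
            linarith only [this, hh, hx, hR]
          have h2 : R ≤ ‖x‖ := le_trans (by linarith only [hR0]) hx
          rw [hGdef, hF.ballCutoff_eq_zero hR0 h1, hF.ballCutoff_eq_zero hR0 h2, sub_zero])
      have hEK : ‖E‖ ≤ K * ρ * ‖h‖ := by
        refine hEn.trans ?_
        have hLR : L / R ≤ L := div_le_self hL0 hR
        rw [Real.mul_rpow (by norm_num) hR0.le]
        calc _ ≤ L * ‖h‖ * (c * (2 ^ (n / 2 : ℝ) * ρ)) := by gcongr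
          _ = L * c * 2 ^ (n / 2 : ℝ) * ρ * ‖h‖ := by ring
          _ ≤ _ := by gcongr
      -- the increment falls on the cutoff, on `f`, or on `g`
      have e1 : bilin n (embL2 n χ) (transL2 h U - U) =
          prodPairing (transL2 h f) (transL2 h g) (schwartzMult (freeSymbol n t)
            (SchwartzMap.smulLeftCLM ℂ (fun x => G (x + h) - G x) χ)) +
          prodPairing (transL2 h f - f) (transL2 h g) (schwartzMult (freeSymbol n t)
            (SchwartzMap.smulLeftCLM ℂ G χ)) +
          prodPairing f (transL2 h g - g) (schwartzMult (freeSymbol n t)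
            (SchwartzMap.smulLeftCLM ℂ G χ)) := by
        have e2 : SchwartzMap.smulLeftCLM ℂ (fun x => G (x + h) - G x) χ =
            SchwartzMap.smulLeftCLM ℂ (fun x => G (x + h)) χ -
              SchwartzMap.smulLeftCLM ℂ G χ := by
          ext x
          rw [_root_.sub_apply, SchwartzMap.smulLeftCLM_apply_apply hdiff,
            SchwartzMap.smulLeftCLM_apply_apply hGh, SchwartzMap.smulLeftCLM_apply_apply hG,
            sub_smul]
        rw [map_sub, bilin_transL2, ← hUχ', ← hUχ', prodPairing_freeSymbol_translate t hG, e2,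
          map_sub, prodPairing_sub, prodPairing_sub_left, prodPairing_sub_right]
        ring
      rw [e1]
      refine (norm_add₃_le).trans ?_
      rw [add_mul, add_mul]
      have b1 := norm_prodPairing_freeSymbol_le ht hdiff hE (transL2 h f) (transL2 h g) χ
      have b2 := hbase (transL2 h f - f) (transL2 h g) χ
      have b3 := hbase f (transL2 h g - g) χ
      simp only [LinearIsometry.norm_map] at b1 b2 b3
      refine add_le_add_three (b1.trans ?_) (b2.trans ?_) (b3.trans ?_)
      · calc _ ≤ d * (K * ρ * ‖h‖) * ‖u‖ * ‖v‖ * ‖embL2 n χ‖ := by gcongr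
          _ = _ := by ring
      · calc _ ≤ d * K * ρ * ‖transL2 h f - f‖ * ‖v‖ * ‖embL2 n χ‖ := by gcongr
          _ = _ := by ring
      · calc _ ≤ d * K * ρ * ‖u‖ * ‖transL2 h g - g‖ * ‖embL2 n χ‖ := by gcongr
          _ = _ := by ring
  have hfin := norm_toDistr_besselSymbol_le w κ
  rw [toL2_spec ha0 w, hw, toTemperedDistribution_apply_eq_bilin, ← hUχ'] at hfin
  refine hfin.trans ?_
  calc _ ≤ D * (d * K * ρ * ‖u‖ * ‖v‖) * ‖embL2 n κ‖ := by gcongr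
    _ = _ := by ring

/-! ### The time dependence of the free flow -/

/-- The symbol of `H₀ = -Δ`. -/
def kineticSymbol (n : ℕ) (ξ : Eucl n) : ℂ := (((2 * Real.pi) ^ 2 * ‖ξ‖ ^ 2 : ℝ) : ℂ)

theorem kineticSymbol_hasTemperateGrowth (n : ℕ) : (kineticSymbol n).HasTemperateGrowth := by
  unfold kineticSymbol
  fun_prop

theorem schwartzMult_sub_symbol {m₁ m₂ : Eucl n → ℂ} (h₁ : m₁.HasTemperateGrowth)
    (h₂ : m₂.HasTemperateGrowth) (χ : 𝓢(Eucl n, ℂ)) :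
    schwartzMult (m₁ - m₂) χ = schwartzMult m₁ χ - schwartzMult m₂ χ := by
  have h₃ : (m₁ - m₂).HasTemperateGrowth := h₁.sub h₂
  have h : SchwartzMap.smulLeftCLM ℂ (m₁ - m₂) (𝓕⁻ χ) =
      SchwartzMap.smulLeftCLM ℂ m₁ (𝓕⁻ χ) - SchwartzMap.smulLeftCLM ℂ m₂ (𝓕⁻ χ) := by
    ext ξ
    rw [_root_.sub_apply, SchwartzMap.smulLeftCLM_apply_apply h₁,
      SchwartzMap.smulLeftCLM_apply_apply h₂, SchwartzMap.smulLeftCLM_apply_apply h₃,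
      Pi.sub_apply, sub_smul]
  rw [schwartzMult_apply, h]
  exact map_sub (FourierTransform.fourierCLM ℂ 𝓢(Eucl n, ℂ)) _ _

theorem schwartzMult_smul_symbol {m : Eucl n → ℂ} (h : m.HasTemperateGrowth) (c : ℂ)
    (χ : 𝓢(Eucl n, ℂ)) : schwartzMult (c • m) χ = c • schwartzMult m χ := by
  have h₃ : (c • m).HasTemperateGrowth := (Function.HasTemperateGrowth.const c).smul h
  have h : SchwartzMap.smulLeftCLM ℂ (c • m) (𝓕⁻ χ) =
      c • SchwartzMap.smulLeftCLM ℂ m (𝓕⁻ χ) := by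
    ext ξ
    rw [_root_.smul_apply, SchwartzMap.smulLeftCLM_apply_apply h,
      SchwartzMap.smulLeftCLM_apply_apply h₃, Pi.smul_apply, smul_assoc]
  rw [schwartzMult_apply, h]
  exact map_smul (FourierTransform.fourierCLM ℂ 𝓢(Eucl n, ℂ)) _ _

theorem laplacian_apply_eq (u : 𝓢'(Eucl n, ℂ)) (χ : 𝓢(Eucl n, ℂ)) :
    (Δ u) χ = -u (schwartzMult (kineticSymbol n) χ) := by
  have hsq : (fun ξ : Eucl n => ((‖ξ‖ ^ 2 : ℝ) : ℂ)).HasTemperateGrowth := by fun_prop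
  have h1 : kineticSymbol n =
      (((2 * Real.pi) ^ 2 : ℝ) : ℂ) • fun ξ : Eucl n => ((‖ξ‖ ^ 2 : ℝ) : ℂ) := by
    funext ξ
    simp [kineticSymbol]
  rw [TemperedDistribution.laplacian_eq_fourierMultiplierCLM, h1, schwartzMult_smul_symbol hsq,
    map_smul]
  simp [← fourierMultiplier_apply_eq]

theorem norm_embL2_schwartzMult_le_of_le {m₁ m₂ : Eucl n → ℂ} (h₁ : m₁.HasTemperateGrowth)
    (h₂ : m₂.HasTemperateGrowth) {C : ℝ} (h : ∀ ξ, ‖m₁ ξ‖ ≤ C * ‖m₂ ξ‖) (χ : 𝓢(Eucl n, ℂ)) :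
    ‖embL2 n (schwartzMult m₁ χ)‖ ≤ C * ‖embL2 n (schwartzMult m₂ χ)‖ := by
  rw [norm_embL2_schwartzMult, norm_embL2_schwartzMult]
  refine norm_embL2_le_of_forall_le fun ξ => ?_
  rw [SchwartzMap.smulLeftCLM_apply_apply h₁, SchwartzMap.smulLeftCLM_apply_apply h₂, smul_eq_mul,
    smul_eq_mul, norm_mul, norm_mul, ← mul_assoc]
  gcongr
  exact h ξ

theorem SobolevSpace.norm_toDistr_schwartzMult_le {a : ℝ} (u : SobolevSpace n a)
    {m₁ m₂ : Eucl n → ℂ} (h₁ : m₁.HasTemperateGrowth) (h₂ : m₂.HasTemperateGrowth) {C : ℝ}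
    (h : ∀ ξ, ‖m₁ ξ‖ ≤ C * ‖m₂ ξ‖) (χ : 𝓢(Eucl n, ℂ)) :
    ‖toDistr u (schwartzMult m₁ χ)‖ ≤
      C * ‖u‖ * ‖embL2 n (schwartzMult m₂ (schwartzMult (besselSymbol n (-a)) χ))‖ := by
  have h3 := norm_toDistr_besselSymbol_le u
    (schwartzMult m₁ (schwartzMult (besselSymbol n (-a)) χ))
  rw [schwartzMult_comm (besselSymbol_hasTemperateGrowth _) h₁, schwartzMult_besselSymbol_neg] at h3
  refine h3.trans ?_
  rw [mul_comm C, mul_assoc]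
  gcongr
  exact norm_embL2_schwartzMult_le_of_le h₁ h₂ h _

theorem norm_exp_I_mul_sub_one_sub_le (x : ℝ) :
    ‖Complex.exp (Complex.I * x) - 1 - Complex.I * x‖ ≤ 2 * x ^ 2 := by
  have hn : ‖Complex.I * (x : ℂ)‖ = |x| := by simp
  rcases le_or_gt |x| 1 with h | h
  · refine (Complex.norm_exp_sub_one_sub_id_le (by rwa [hn])).trans ?_
    rw [hn, sq_abs]
    nlinarith [sq_nonneg x]
  · refine (norm_sub_le _ _).trans ?_
    have h2 := Real.norm_exp_I_mul_ofReal_sub_one_le (x := x)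
    rw [Real.norm_eq_abs] at h2
    rw [hn, ← sq_abs x]
    nlinarith

theorem norm_freeSymbol (t : ℝ) (ξ : Eucl n) : ‖freeSymbol n t ξ‖ = 1 := by
  have : -(Complex.I * ((t * ((2 * Real.pi) ^ 2 * ‖ξ‖ ^ 2) : ℝ) : ℂ)) =
      ((-(t * ((2 * Real.pi) ^ 2 * ‖ξ‖ ^ 2)) : ℝ) : ℂ) * Complex.I := by
    push_cast; ring
  rw [freeSymbol, this, Complex.norm_exp_ofReal_mul_I]

theorem freeSymbol_neg_add (t r : ℝ) (ξ : Eucl n) : freeSymbol n (-(t + r)) ξ =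
    freeSymbol n (-t) ξ *
      Complex.exp (Complex.I * ((r * ((2 * Real.pi) ^ 2 * ‖ξ‖ ^ 2) : ℝ) : ℂ)) := by
  rw [freeSymbol, freeSymbol, ← Complex.exp_add]
  congr 1
  push_cast
  ring

/-- The backward free flow of a test function is Lipschitz continuous in time, when tested against
elements of `H^a`. -/
theorem SobolevSpace.norm_toDistr_freeSymbol_sub_le {a : ℝ} (u : SobolevSpace n a) (t r : ℝ)
    (χ : 𝓢(Eucl n, ℂ)) :
    ‖toDistr u (schwartzMult (freeSymbol n (-(t + r))) χ) -
        toDistr u (schwartzMult (freeSymbol n (-t)) χ)‖ ≤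
      |r| * ‖u‖ * ‖embL2 n (schwartzMult (kineticSymbol n)
        (schwartzMult (besselSymbol n (-a)) χ))‖ := by
  have h1 := freeSymbol_hasTemperateGrowth n (-(t + r))
  have h2 := freeSymbol_hasTemperateGrowth n (-t)
  rw [← map_sub, ← schwartzMult_sub_symbol h1 h2]
  refine norm_toDistr_schwartzMult_le u (h1.sub h2) (kineticSymbol_hasTemperateGrowth n)
    (fun ξ => ?_) χ
  rw [Pi.sub_apply, freeSymbol_neg_add, ← mul_sub_one, norm_mul, norm_freeSymbol, one_mul]
  refine Real.norm_exp_I_mul_ofReal_sub_one_le.trans (le_of_eq ?_)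
  rw [norm_mul, kineticSymbol, Complex.norm_real, Real.norm_eq_abs r]

/-- The first order expansion in time of the backward free flow of a test function, tested against
elements of `H^a`. -/
theorem SobolevSpace.norm_toDistr_freeSymbol_sub_sub_le {a : ℝ} (u : SobolevSpace n a) (t r : ℝ)
    (χ : 𝓢(Eucl n, ℂ)) :
    ‖toDistr u (schwartzMult (freeSymbol n (-(t + r))) χ) -
        toDistr u (schwartzMult (freeSymbol n (-t)) χ) -
        r * Complex.I * toDistr u
          (schwartzMult (kineticSymbol n) (schwartzMult (freeSymbol n (-t)) χ))‖ ≤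
      2 * r ^ 2 * ‖u‖ * ‖embL2 n (schwartzMult (kineticSymbol n * kineticSymbol n)
        (schwartzMult (besselSymbol n (-a)) χ))‖ := by
  have h1 := freeSymbol_hasTemperateGrowth n (-(t + r))
  have h2 := freeSymbol_hasTemperateGrowth n (-t)
  have hk := kineticSymbol_hasTemperateGrowth n
  have h3 : ((r * Complex.I) • (kineticSymbol n * freeSymbol n (-t))).HasTemperateGrowth :=
    (Function.HasTemperateGrowth.const (r * Complex.I)).smul (hk.mul h2)
  rw [schwartzMult_schwartzMult hk h2, ← smul_eq_mul (r * Complex.I), ← map_smul, ← map_sub,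
    ← map_sub, ← schwartzMult_smul_symbol (hk.mul h2),
    ← schwartzMult_sub_symbol h1 h2, ← schwartzMult_sub_symbol (h1.sub h2) h3]
  refine norm_toDistr_schwartzMult_le u ((h1.sub h2).sub h3) (hk.mul hk) (fun ξ => ?_) χ
  have e : (freeSymbol n (-(t + r)) - freeSymbol n (-t) -
      (r * Complex.I) • (kineticSymbol n * freeSymbol n (-t))) ξ = freeSymbol n (-t) ξ *
      (Complex.exp (Complex.I * ((r * ((2 * Real.pi) ^ 2 * ‖ξ‖ ^ 2) : ℝ) : ℂ)) - 1 -
        Complex.I * ((r * ((2 * Real.pi) ^ 2 * ‖ξ‖ ^ 2) : ℝ) : ℂ)) := by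
    simp only [Pi.sub_apply, Pi.smul_apply, Pi.mul_apply, freeSymbol_neg_add, kineticSymbol,
      smul_eq_mul]
    push_cast
    ring
  rw [e, norm_mul, norm_freeSymbol, one_mul]
  refine (norm_exp_I_mul_sub_one_sub_le _).trans (le_of_eq ?_)
  rw [Pi.mul_apply, norm_mul, kineticSymbol, Complex.norm_real,
    Real.norm_of_nonneg (by positivity)]
  ring

/-! ### The equation tested with Schwartz functions -/

namespace SobolevSpace

variable {a : ℝ}

theorem toDistr_apply_eq_bilin (ha : 0 ≤ a) (u : SobolevSpace n a) (χ : 𝓢(Eucl n, ℂ)) :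
    toDistr u χ = bilin n (embL2 n χ) (toL2 ha u) := by
  rw [toL2_spec ha, toTemperedDistribution_apply_eq_bilin]

theorem toL2_sub (ha : 0 ≤ a) (u v : SobolevSpace n a) :
    toL2 ha (u - v) = toL2 ha u - toL2 ha v := by
  apply lp_toTemperedDistribution_injective
  change Lp.toTemperedDistribution _ = Lp.toTemperedDistribution _
  rw [← toL2_spec, map_sub, toL2_spec ha u, toL2_spec ha v]
  simp only [← Lp.toTemperedDistributionCLM_apply, map_sub]

theorem continuous_toL2 (ha : 0 ≤ a) : Continuous (toL2 ha : SobolevSpace n a → L2 n) := by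
  refine (LipschitzWith.of_dist_le_mul (K := 1) fun u v => ?_).continuous
  rw [dist_eq_norm, dist_eq_norm, ← toL2_sub, NNReal.coe_one, one_mul]
  exact norm_toL2_le ha _

end SobolevSpace

open SobolevSpace

theorem continuous_distr_apply {ι : Type*} [TopologicalSpace ι] {u : ι → 𝓢'(Eucl n, ℂ)}
    (hu : Continuous u) (χ : 𝓢(Eucl n, ℂ)) : Continuous fun t => u t χ :=
  (continuous_eval_const χ).comp hu

/-- A bounded curve in `H^a`, `a ≥ 0`, which is continuous in the sense of distributions is weakly
continuous in `L²`. -/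
theorem continuous_bilin_toL2 {a : ℝ} (ha : 0 ≤ a) {ψ : ℝ → SobolevSpace n a} {C : ℝ}
    (hψ : Continuous fun t => toDistr (ψ t)) (hC : ∀ t, ‖ψ t‖ ≤ C) (g : L2 n) :
    Continuous fun t => bilin n g (toL2 ha (ψ t)) := by
  refine continuous_iff_continuousAt.2 fun t => ?_
  refine tendsto_bilin_of_schwartz (C := C)
    (Eventually.of_forall fun s => (norm_toL2_le ha _).trans (hC s)) (fun χ => ?_) g
  simp only [← toDistr_apply_eq_bilin]
  exact (continuous_distr_apply hψ χ).tendsto t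

theorem continuous_prodPairing_left (g : L2 n) (χ : 𝓢(Eucl n, ℂ)) :
    Continuous fun f => prodPairing f g χ := by
  refine (LipschitzWith.of_dist_le_mul
    (K := NNReal.mk (SchwartzMap.seminorm ℝ 0 0 χ * ‖g‖) (by positivity))
    fun f f' => ?_).continuous
  rw [dist_eq_norm, dist_eq_norm, ← prodPairing_sub_left]
  refine (norm_prodPairing_le _ _ (fun x => χ.norm_le_seminorm ℝ x)).trans (le_of_eq ?_)
  rw [NNReal.coe_mk]
  ring

theorem exists_prodPairing_eq_bilin (f : L2 n) (χ : 𝓢(Eucl n, ℂ)) :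
    ∃ k : L2 n, ∀ g, prodPairing f g χ = bilin n k g := by
  obtain ⟨k, -, hk⟩ := exists_L2_smul χ.hasTemperateGrowth
    (fun x => χ.norm_le_seminorm ℝ x) f
  refine ⟨k, fun g => ?_⟩
  rw [bilin_apply, prodPairing]
  refine integral_congr_ae ?_
  filter_upwards [hk] with x hx
  rw [hx]
  ring

/-- The pairing of the product of a measurable and a weakly continuous curve with a test function
is measurable: it is a Carathéodory function of the time and of the value of the first factor. -/
theorem aestronglyMeasurable_prodPairing {a : ℝ} (ha : 0 ≤ a) {ψ V : ℝ → SobolevSpace n a} {C : ℝ}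
    (hψ : Continuous fun t => toDistr (ψ t)) (hC : ∀ t, ‖ψ t‖ ≤ C)
    (hV : AEStronglyMeasurable V volume) (χ : 𝓢(Eucl n, ℂ)) :
    AEStronglyMeasurable (fun t => prodPairing (toL2 ha (V t)) (toL2 ha (ψ t)) χ) volume := by
  borelize (L2 n)
  have : Fact ((2 : ℝ≥0∞) ≠ ⊤) := ⟨by norm_num⟩
  have h1 : StronglyMeasurable
      (Function.uncurry fun (f : L2 n) (t : ℝ) => prodPairing f (toL2 ha (ψ t)) χ) := by
    refine stronglyMeasurable_uncurry_of_continuous_of_stronglyMeasurable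
      (fun t => continuous_prodPairing_left _ χ) fun f => ?_
    obtain ⟨k, hk⟩ := exists_prodPairing_eq_bilin f χ
    simp only [hk]
    exact (continuous_bilin_toL2 ha hψ hC k).stronglyMeasurable
  have h2 : AEStronglyMeasurable (fun t => toL2 ha (V t)) volume :=
    (continuous_toL2 ha).comp_aestronglyMeasurable hV
  refine ⟨fun t => prodPairing (h2.mk _ t) (toL2 ha (ψ t)) χ,
    h1.comp_measurable (h2.stronglyMeasurable_mk.measurable.prodMk measurable_id), ?_⟩
  filter_upwards [h2.ae_eq_mk] with t ht
  rw [← ht]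

/-- The weak formulation of the equation between two times, with the interaction written as a
product of two elements of `H^a`. Splitting the integral needs the integrability of the interaction
term, which is where the measurability of `V` enters. -/
theorem IsGlobalSolution.sub_eq_integral {a : ℝ} {ha : 0 ≤ a} {N : Eucl n → ℝ → (Eucl n → ℝ) → ℂ}
    {ψ V : ℝ → SobolevSpace n a} (hψ : IsGlobalSolution ha N ψ) {C : ℝ} (hC : ∀ t, ‖ψ t‖ ≤ C)
    (hV : AEStronglyMeasurable V volume) {CV : ℝ} (hCV : ∀ᵐ t, ‖V t‖ ≤ CV)
    (hVN : ∀ᵐ t, ∀ᵐ x, toL2 ha (V t) x = N x t (fun y => ‖toL2 ha (ψ t) y‖))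
    (χ : 𝓢(Eucl n, ℂ)) (t₁ t₂ : ℝ) :
    toDistr (ψ t₂) χ - toDistr (ψ t₁) χ =
      -(Complex.I * ∫ s in t₁..t₂, toDistr (ψ s) (schwartzMult (kineticSymbol n) χ)) -
        Complex.I * ∫ s in t₁..t₂, prodPairing (toL2 ha (V s)) (toL2 ha (ψ s)) χ := by
  set q : ℝ → ℂ := fun s => toDistr (ψ s) (schwartzMult (kineticSymbol n) χ) with hq
  set b : ℝ → ℂ := fun s => prodPairing (toL2 ha (V s)) (toL2 ha (ψ s)) χ with hb
  have hqi : ∀ s₁ s₂, IntervalIntegrable q volume s₁ s₂ := fun s₁ s₂ =>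
    (continuous_distr_apply hψ.continuous _).intervalIntegrable s₁ s₂
  have hbi : ∀ s₁ s₂, IntervalIntegrable b volume s₁ s₂ := by
    intro s₁ s₂
    refine (intervalIntegrable_const (c := SchwartzMap.seminorm ℝ 0 0 χ * (CV * C))).mono_fun
      (aestronglyMeasurable_prodPairing ha hψ.continuous hC hV χ).restrict ?_
    refine ae_restrict_of_ae ?_
    filter_upwards [hCV] with s hs
    refine (norm_prodPairing_le _ _ (fun x => χ.norm_le_seminorm ℝ x)).trans
      ((le_abs_self _).trans' ?_)
    have h1 := (norm_toL2_le ha (V s)).trans hs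
    have h2 := (norm_toL2_le ha (ψ s)).trans (hC s)
    have h3 : 0 ≤ CV := (norm_nonneg _).trans h1
    gcongr
  have hgi : ∀ s₁ s₂, IntervalIntegrable (fun s => -Complex.I * q s - Complex.I * b s)
      volume s₁ s₂ := fun s₁ s₂ =>
    ((hqi s₁ s₂).const_mul _).sub ((hbi s₁ s₂).const_mul _)
  have h0 : ∀ t, toDistr (ψ t) χ - toDistr (ψ 0) χ =
      ∫ s in (0 : ℝ)..t, (-Complex.I * q s - Complex.I * b s) := by
    intro t
    rw [hψ.equation χ t]
    refine intervalIntegral.integral_congr_ae ?_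
    filter_upwards [hVN] with s hs _
    rw [laplacian_apply_eq, hq, hb, mul_neg, neg_mul]
    congr 2
    refine integral_congr_ae ?_
    filter_upwards [hs] with x hx
    rw [hx]
  have h1 : toDistr (ψ t₂) χ - toDistr (ψ t₁) χ =
      (toDistr (ψ t₂) χ - toDistr (ψ 0) χ) - (toDistr (ψ t₁) χ - toDistr (ψ 0) χ) := by ring
  rw [h1, h0, h0, intervalIntegral.integral_interval_sub_left (hgi _ _) (hgi _ _),
    intervalIntegral.integral_sub ((hqi _ _).const_mul _) ((hbi _ _).const_mul _),
    intervalIntegral.integral_const_mul, intervalIntegral.integral_const_mul, neg_mul]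

/-! ### Cook's estimate -/

/-- The pairing of `e^{itH₀} ψ(t)` with a test function is continuous in `t`. -/
theorem continuous_toDistr_freeSymbol {a : ℝ} {ψ : ℝ → SobolevSpace n a} {C : ℝ}
    (hψ : Continuous fun t => toDistr (ψ t)) (hC : ∀ t, ‖ψ t‖ ≤ C) (η : 𝓢(Eucl n, ℂ)) :
    Continuous fun t => toDistr (ψ t) (schwartzMult (freeSymbol n (-t)) η) := by
  refine continuous_iff_continuousAt.2 fun t => ?_
  set ζ := schwartzMult (freeSymbol n (-t)) η with hζ
  set K := ‖embL2 n (schwartzMult (kineticSymbol n) (schwartzMult (besselSymbol n (-a)) η))‖ with hK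
  have h1 : Tendsto (fun s => toDistr (ψ s) ζ) (𝓝 t) (𝓝 (toDistr (ψ t) ζ)) :=
    (continuous_distr_apply hψ ζ).tendsto t
  have h2 : Tendsto (fun s => toDistr (ψ s) (schwartzMult (freeSymbol n (-s)) η) -
      toDistr (ψ s) ζ) (𝓝 t) (𝓝 0) := by
    have h3 : Tendsto (fun s => |s - t| * C * K) (𝓝 t) (𝓝 0) := by
      have : Continuous fun s => |s - t| * C * K := by fun_prop
      simpa using this.tendsto t
    refine squeeze_zero_norm (fun s => ?_) h3
    have h4 := norm_toDistr_freeSymbol_sub_le (ψ s) t (s - t) η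
    rw [add_sub_cancel] at h4
    refine h4.trans ?_
    gcongr
    exact hC s
  simpa [ContinuousAt, hζ] using h2.add h1

/-- The right upper derivative of the pairing of `e^{itH₀} ψ(t)` with a test function is controlled
by the interaction term only: the contributions of the free Hamiltonian cancel. -/
theorem IsGlobalSolution.eventually_norm_sub_le {a : ℝ} {ha : 0 ≤ a}
    {N : Eucl n → ℝ → (Eucl n → ℝ) → ℂ}
    {ψ V : ℝ → SobolevSpace n a} (hψ : IsGlobalSolution ha N ψ) {C : ℝ} (hC : ∀ t, ‖ψ t‖ ≤ C)
    (hV : AEStronglyMeasurable V volume) {CV : ℝ} (hCV : ∀ᵐ t, ‖V t‖ ≤ CV)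
    (hVN : ∀ᵐ t, ∀ᵐ x, toL2 ha (V t) x = N x t (fun y => ‖toL2 ha (ψ t) y‖))
    (η : 𝓢(Eucl n, ℂ)) (t : ℝ) {P : ℝ}
    (hP : ∀ᵐ s, ‖prodPairing (toL2 ha (V s)) (toL2 ha (ψ s))
      (schwartzMult (freeSymbol n (-t)) η)‖ ≤ P) {ε : ℝ} (hε : 0 < ε) :
    ∀ᶠ z in 𝓝[>] t, ‖toDistr (ψ z) (schwartzMult (freeSymbol n (-z)) η) -
      toDistr (ψ t) (schwartzMult (freeSymbol n (-t)) η)‖ ≤ (P + ε) * (z - t) := by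
  set ζ := schwartzMult (freeSymbol n (-t)) η with hζ
  set q : ℝ → ℂ := fun s => toDistr (ψ s) (schwartzMult (kineticSymbol n) ζ) with hq
  have hqc : Continuous q := continuous_distr_apply hψ.continuous _
  set K := ‖embL2 n (schwartzMult (kineticSymbol n * kineticSymbol n)
    (schwartzMult (besselSymbol n (-a)) η))‖ with hK
  obtain ⟨δ, hδ, hqδ⟩ := Metric.continuous_iff.1 hqc t (ε / 4) (by positivity)
  have hsmall : ∀ᶠ z in 𝓝[>] t, 2 * (z - t) * C * K < ε / 2 := by
    have hc : Continuous fun z : ℝ => 2 * (z - t) * C * K := by fun_prop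
    refine (hc.continuousAt.eventually_lt_const ?_).filter_mono nhdsWithin_le_nhds
    simpa using half_pos hε
  filter_upwards [hsmall, self_mem_nhdsWithin,
    nhdsWithin_le_nhds (Metric.ball_mem_nhds t hδ)] with z hz1 hz2 hz3
  have hzt : 0 < z - t := sub_pos.2 hz2
  have hqz : ∀ s ∈ Set.Icc t z, ‖q s - q t‖ ≤ ε / 4 := fun s hs => by
    rw [← dist_eq_norm]
    refine (hqδ s ?_).le
    rw [Metric.mem_ball, Real.dist_eq, abs_of_pos hzt] at hz3
    rw [Real.dist_eq, abs_of_nonneg (sub_nonneg.2 hs.1)]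
    linarith [hs.2]
  -- the three contributions: the variation of `q`, the interaction, and the Taylor remainder
  have e1 : toDistr (ψ z) (schwartzMult (freeSymbol n (-z)) η) - toDistr (ψ t) ζ =
      Complex.I * (∫ s in t..z, (q z - q s)) -
        Complex.I * (∫ s in t..z, prodPairing (toL2 ha (V s)) (toL2 ha (ψ s)) ζ) +
      (toDistr (ψ z) (schwartzMult (freeSymbol n (-z)) η) - toDistr (ψ z) ζ -
        (z - t : ℝ) * Complex.I * q z) := by
    have h1 := hψ.sub_eq_integral hC hV hCV hVN ζ t z
    rw [intervalIntegral.integral_sub intervalIntegrable_const (hqc.intervalIntegrable t z),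
      intervalIntegral.integral_const, Complex.real_smul]
    linear_combination h1
  have b1 : ‖∫ s in t..z, (q z - q s)‖ ≤ ε / 2 * (z - t) := by
    rw [← abs_of_pos hzt]
    refine intervalIntegral.norm_integral_le_of_norm_le_const fun s hs => ?_
    rw [Set.uIoc_of_le hz2.le] at hs
    have h1 := hqz s ⟨hs.1.le, hs.2⟩
    have h2 := hqz z ⟨hz2.le, le_rfl⟩
    have h3 := norm_sub_le (q z - q t) (q s - q t)
    rw [sub_sub_sub_cancel_right] at h3
    linarith
  have b2 : ‖∫ s in t..z, prodPairing (toL2 ha (V s)) (toL2 ha (ψ s)) ζ‖ ≤ P * (z - t) := by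
    rw [← abs_of_pos hzt]
    refine intervalIntegral.norm_integral_le_of_norm_le_const_ae ?_
    filter_upwards [hP] with s hs _ using hs
  have b3 : ‖toDistr (ψ z) (schwartzMult (freeSymbol n (-z)) η) - toDistr (ψ z) ζ -
      (z - t : ℝ) * Complex.I * q z‖ ≤ ε / 2 * (z - t) := by
    have h1 := norm_toDistr_freeSymbol_sub_sub_le (ψ z) t (z - t) η
    rw [add_sub_cancel] at h1
    refine h1.trans ?_
    calc _ ≤ 2 * (z - t) ^ 2 * C * K := by gcongr; exact hC z
      _ = 2 * (z - t) * C * K * (z - t) := by ring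
      _ ≤ _ := by gcongr
  rw [e1]
  refine (norm_add_le _ _).trans ?_
  have h4 := norm_sub_le (Complex.I * (∫ s in t..z, (q z - q s)))
    (Complex.I * (∫ s in t..z, prodPairing (toL2 ha (V s)) (toL2 ha (ψ s)) ζ))
  rw [norm_mul, norm_mul, Complex.norm_I, one_mul, one_mul] at h4
  linarith

/-- A continuous curve whose right difference quotients at `t` are bounded by `c t^{-p}`, `p > 1`,
varies by `O(t^{1-p})` after the time `t`. -/
theorem norm_sub_le_of_right_slope {E : Type*} [NormedAddCommGroup E] {m : ℝ → E}
    (hm : Continuous m) {c p : ℝ} (hc : 0 ≤ c) (hp : 1 < p) {t₀ : ℝ} (ht₀ : 0 < t₀)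
    (h : ∀ t ≥ t₀, ∀ ε > 0, ∀ᶠ z in 𝓝[>] t, ‖m z - m t‖ ≤ (c * t ^ (-p) + ε) * (z - t))
    {t₁ : ℝ} (ht₁ : t₀ ≤ t₁) : ‖m t₁ - m t₀‖ ≤ c / (p - 1) * t₀ ^ (1 - p) := by
  have hp0 : 0 < p - 1 := by linarith
  have key := image_le_of_liminf_slope_right_le_deriv_boundary (f := fun t => ‖m t - m t₀‖)
    (a := t₀) (b := t₁) (B := fun t => c / (p - 1) * (t₀ ^ (1 - p) - t ^ (1 - p)))
    (B' := fun t => c * t ^ (-p)) (by fun_prop) (by simp)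
    (by
      intro t ht
      have h0 : t ≠ 0 := (ht₀.trans_le ht.1).ne'
      exact ((continuousAt_const.sub (Real.continuousAt_rpow_const _ _ (Or.inl h0))).const_mul
        _).continuousWithinAt)
    (by
      intro t ht
      have h0 : t ≠ 0 := (ht₀.trans_le ht.1).ne'
      have h1 := ((Real.hasDerivAt_rpow_const (p := 1 - p) (Or.inl h0)).const_sub
        (t₀ ^ (1 - p))).const_mul (c / (p - 1))
      refine (h1.congr_deriv ?_).hasDerivWithinAt
      rw [show 1 - p - 1 = -p by ring]
      field_simp
      ring)
    (by
      intro t ht r hr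
      refine Eventually.frequently ?_
      filter_upwards [h t ht.1 ((r - c * t ^ (-p)) / 2) (by linarith), self_mem_nhdsWithin]
        with z hz1 hz2
      have hzt : 0 < z - t := sub_pos.2 hz2
      rw [slope_def_field, div_lt_iff₀ hzt]
      have h3 := norm_sub_norm_le (m z - m t₀) (m t - m t₀)
      rw [sub_sub_sub_cancel_right] at h3
      refine (h3.trans hz1).trans_lt ?_
      gcongr
      linarith)
    ⟨ht₁, le_rfl⟩
  refine key.trans ?_
  have h1 : 0 ≤ t₁ ^ (1 - p) := Real.rpow_nonneg (by linarith) _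
  gcongr
  linarith

theorem dispersiveConst_neg_of_pos {t : ℝ} (ht : 0 < t) :
    dispersiveConst n (-t) = (Real.pi / (2 * Real.pi) ^ 2) ^ (n / 2 : ℝ) * t ^ (-(n / 2 : ℝ)) := by
  rw [dispersiveConst, abs_neg, abs_of_pos ht, Real.rpow_neg ht.le, ← div_eq_mul_inv,
    ← Real.div_rpow (by positivity) ht.le]
  congr 1
  rw [div_div, mul_comm t]

/-- Cook's estimate, localised in the interaction picture to a ball of radius `R`: the component of
`e^{itH₀} ψ(t)` in the ball varies in `H^a` by `O(R^{n/2} t^{1-n/2})` after the time `t`. -/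
theorem IsGlobalSolution.exists_norm_sub_le {a : ℝ} {ha : 0 ≤ a} (ha1 : a ≤ 1) (hn : 3 ≤ n)
    {N : Eucl n → ℝ → (Eucl n → ℝ) → ℂ}
    {ψ V : ℝ → SobolevSpace n a} (hψ : IsGlobalSolution ha N ψ) {C : ℝ} (hC : ∀ t, ‖ψ t‖ ≤ C)
    (hV : AEStronglyMeasurable V volume) {CV : ℝ} (hCV : ∀ᵐ t, ‖V t‖ ≤ CV)
    (hVN : ∀ᵐ t, ∀ᵐ x, toL2 ha (V t) x = N x t (fun y => ‖toL2 ha (ψ t) y‖))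
    {F : ℝ → ℝ} (hF : IsSmoothCutoff F) :
    ∃ K : ℝ, 0 ≤ K ∧ ∀ (R t₁ t₂ : ℝ) (κ : 𝓢(Eucl n, ℂ)), 1 ≤ R → 0 < t₁ → t₁ ≤ t₂ →
      ‖freeFlow n (-t₂) (toDistr (ψ t₂)) (SchwartzMap.smulLeftCLM ℂ (ballCutoff n F R)
          (schwartzMult (besselSymbol n a) κ)) -
        freeFlow n (-t₁) (toDistr (ψ t₁)) (SchwartzMap.smulLeftCLM ℂ (ballCutoff n F R)
          (schwartzMult (besselSymbol n a) κ))‖ ≤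
        K * R ^ (n / 2 : ℝ) * t₁ ^ (1 - n / 2 : ℝ) * ‖embL2 n κ‖ := by
  obtain ⟨D, hD, hstat⟩ := exists_norm_prodPairing_freeSymbol_le n ha ha1 hF
  have hn' : (1 : ℝ) < n / 2 := by
    have : (3 : ℝ) ≤ n := by exact_mod_cast hn
    linarith
  have hC0 : 0 ≤ C := (norm_nonneg _).trans (hC 0)
  have hCV0 : 0 ≤ CV := by
    obtain ⟨s, hs⟩ := hCV.exists
    exact (norm_nonneg _).trans hs
  set k : ℝ := (Real.pi / (2 * Real.pi) ^ 2) ^ (n / 2 : ℝ) with hk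
  have hk0 : 0 ≤ k := by positivity
  refine ⟨D * k * CV * C / (n / 2 - 1), div_nonneg (by positivity) (by linarith),
    fun R t₁ t₂ κ hR ht₁ ht₂ => ?_⟩
  set η := SchwartzMap.smulLeftCLM ℂ (ballCutoff n F R) (schwartzMult (besselSymbol n a) κ) with hη
  refine (norm_sub_le_of_right_slope (m := fun t => freeFlow n (-t) (toDistr (ψ t)) η)
    (c := D * k * CV * C * R ^ (n / 2 : ℝ) * ‖embL2 n κ‖) (p := n / 2)
    (continuous_toDistr_freeSymbol hψ.continuous hC η) (by positivity) hn' ht₁ ?_ ht₂).trans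
    (le_of_eq (by ring))
  intro t ht ε hε
  have ht0 : 0 < t := ht₁.trans_le ht
  refine hψ.eventually_norm_sub_le hC hV hCV hVN η t ?_ hε
  filter_upwards [hCV] with s hs
  refine (hstat (V s) (ψ s) (-t) R κ (neg_ne_zero.2 ht0.ne') hR).trans ?_
  rw [dispersiveConst_neg_of_pos ht0]
  calc _ ≤ D * (k * t ^ (-(n / 2 : ℝ)) * R ^ (n / 2 : ℝ)) * CV * C * ‖embL2 n κ‖ := by
        gcongr
        exact hC s
    _ = _ := by ring

/-! ### The limit in the interaction picture -/

theorem freeFlow_freeFlow_neg (t : ℝ) (u : 𝓢'(Eucl n, ℂ)) :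
    freeFlow n t (freeFlow n (-t) u) = u := by
  ext χ
  change u (schwartzMult (freeSymbol n (-t)) (schwartzMult (freeSymbol n t) χ)) = u χ
  rw [schwartzMult_schwartzMult (freeSymbol_hasTemperateGrowth n _)
    (freeSymbol_hasTemperateGrowth n _)]
  rw [show freeSymbol n (-t) * freeSymbol n t = fun _ => 1 from ?_, schwartzMult_one]
  funext ξ
  rw [Pi.mul_apply, freeSymbol, freeSymbol, ← Complex.exp_add]
  convert Complex.exp_zero using 2
  push_cast
  ring

theorem freeFlow_neg_freeFlow (t : ℝ) (u : 𝓢'(Eucl n, ℂ)) :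
    freeFlow n (-t) (freeFlow n t u) = u := by
  have := freeFlow_freeFlow_neg (-t) u
  rwa [neg_neg] at this

theorem innerCutoff_eq (F : ℝ → ℝ) (α t : ℝ) (u : 𝓢'(Eucl n, ℂ)) :
    innerCutoff n F α t u = freeFlow n t
      (TemperedDistribution.smulLeftCLM ℂ (ballCutoff n F (t ^ α)) (freeFlow n (-t) u)) := rfl

/-- The two cutoffs add up to the identity; `0 < t` is needed for the symbols to be of temperate
growth. -/
theorem IsSmoothCutoff.outerCutoff_eq {F : ℝ → ℝ} (hF : IsSmoothCutoff F) (α : ℝ) {t : ℝ}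
    (ht : 0 < t) (u : 𝓢'(Eucl n, ℂ)) :
    outerCutoff n F α t u = u - innerCutoff n F α t u := by
  have hR : 0 < t ^ α := Real.rpow_pos_of_pos ht α
  have h : TemperedDistribution.smulLeftCLM ℂ (fun x : Eucl n => ((F (‖x‖ / t ^ α) : ℝ) : ℂ))
      (freeFlow n (-t) u) = freeFlow n (-t) u -
        TemperedDistribution.smulLeftCLM ℂ (ballCutoff n F (t ^ α)) (freeFlow n (-t) u) := by
    ext χ
    rw [_root_.sub_apply, TemperedDistribution.smulLeftCLM_apply_apply,
      TemperedDistribution.smulLeftCLM_apply_apply, ← map_sub]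
    congr 1
    ext x
    rw [_root_.sub_apply, SchwartzMap.smulLeftCLM_apply_apply (hF.hasTemperateGrowth n hR),
      SchwartzMap.smulLeftCLM_apply_apply (hF.ballCutoff_hasTemperateGrowth n hR), ballCutoff,
      smul_eq_mul, smul_eq_mul]
    push_cast
    ring
  rw [innerCutoff_eq]
  change freeFlow n t (TemperedDistribution.smulLeftCLM ℂ _ (freeFlow n (-t) u)) = _
  rw [h, map_sub, freeFlow_freeFlow_neg]

namespace SobolevSpace

variable {a : ℝ}

theorem norm_toDistr_le (u : SobolevSpace n a) (χ : 𝓢(Eucl n, ℂ)) :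
    ‖toDistr u χ‖ ≤ ‖u‖ * ‖embL2 n (schwartzMult (besselSymbol n (-a)) χ)‖ := by
  have := norm_toDistr_besselSymbol_le u (schwartzMult (besselSymbol n (-a)) χ)
  rwa [schwartzMult_besselSymbol_neg] at this

theorem tendsto_toDistr {ι : Type*} {l : Filter ι} {w : ι → SobolevSpace n a}
    {v : SobolevSpace n a} (h : Tendsto w l (𝓝 v)) (χ : 𝓢(Eucl n, ℂ)) :
    Tendsto (fun i => toDistr (w i) χ) l (𝓝 (toDistr v χ)) := by
  rw [tendsto_iff_norm_sub_tendsto_zero] at h ⊢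
  refine squeeze_zero (fun i => norm_nonneg _) (fun i => ?_)
    (by simpa using h.mul_const ‖embL2 n (schwartzMult (besselSymbol n (-a)) χ)‖)
  have := norm_toDistr_le (w i - v) χ
  rwa [map_sub, _root_.sub_apply] at this

theorem exists_freeFlow (t : ℝ) (u : SobolevSpace n a) :
    ∃ w : SobolevSpace n a, toDistr w = freeFlow n t (toDistr u) ∧ ‖w‖ ≤ ‖u‖ := by
  obtain ⟨w, hw, hwu⟩ := exists_fourierMultiplier (freeSymbol_hasTemperateGrowth n t) zero_le_one
    (fun ξ => (norm_freeSymbol t ξ).le) u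
  exact ⟨w, hw, by rwa [one_mul] at hwu⟩

/-- A bounded family in `H^a` which is Cauchy as a family of distributions has a weak limit. -/
theorem exists_tendsto_of_cauchySeq {w : ℝ → SobolevSpace n a} {C : ℝ} (hC : ∀ t, ‖w t‖ ≤ C)
    (h : ∀ χ, CauchySeq fun t => toDistr (w t) χ) :
    ∃ v : SobolevSpace n a, ∀ χ, Tendsto (fun t => toDistr (w t) χ) atTop (𝓝 (toDistr v χ)) := by
  choose l hl using fun χ => cauchySeq_tendsto_of_complete (h χ)
  let L : 𝓢(Eucl n, ℂ) →ₗ[ℂ] ℂ :=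
    { toFun := l
      map_add' := fun χ κ => tendsto_nhds_unique (hl (χ + κ))
        (by simpa only [map_add] using (hl χ).add (hl κ))
      map_smul' := fun c χ => tendsto_nhds_unique (hl (c • χ))
        (by simpa only [map_smul, RingHom.id_apply] using (hl χ).const_smul c) }
  obtain ⟨v, hv, -⟩ := exists_of_bounded_linear (a := a) L ((norm_nonneg _).trans (hC 0))
    fun κ => le_of_tendsto (hl _).norm (Eventually.of_forall fun t =>
      (norm_toDistr_besselSymbol_le (w t) κ).trans (by gcongr; exact hC t))
  refine ⟨v, fun χ => ?_⟩
  rw [hv]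
  exact hl χ

/-- If, after the time `t`, the part of a bounded family in a ball of radius `R` varies at most by
`A(R) r(t)` with `r → 0`, then the family converges weakly, and its parts in balls whose radii grow
slowly enough converge strongly. -/
theorem exists_tendsto_cutoff (ha0 : 0 ≤ a) (ha1 : a ≤ 1) {F : ℝ → ℝ} (hF : IsSmoothCutoff F)
    {w : ℝ → SobolevSpace n a} {C : ℝ} (hC : ∀ t, ‖w t‖ ≤ C) {A r ρ : ℝ → ℝ}
    (hA : ∀ R, 0 ≤ A R) (hr0 : ∀ t > 0, 0 ≤ r t) (hr : Tendsto r atTop (𝓝 0))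
    (hw : ∀ (R t₁ t₂ : ℝ) (κ : 𝓢(Eucl n, ℂ)), 1 ≤ R → 0 < t₁ → t₁ ≤ t₂ →
      ‖toDistr (w t₂) (SchwartzMap.smulLeftCLM ℂ (ballCutoff n F R)
          (schwartzMult (besselSymbol n a) κ)) -
        toDistr (w t₁) (SchwartzMap.smulLeftCLM ℂ (ballCutoff n F R)
          (schwartzMult (besselSymbol n a) κ))‖ ≤ A R * r t₁ * ‖embL2 n κ‖)
    (hρ : Tendsto ρ atTop atTop) (hρr : Tendsto (fun t => A (ρ t) * r t) atTop (𝓝 0)) :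
    ∃ (v : SobolevSpace n a) (y : ℝ → SobolevSpace n a),
      (∀ χ, Tendsto (fun t => toDistr (w t) χ) atTop (𝓝 (toDistr v χ))) ∧
      (∀ t, 0 < ρ t → toDistr (y t) =
        TemperedDistribution.smulLeftCLM ℂ (ballCutoff n F (ρ t)) (toDistr (w t))) ∧
      Tendsto y atTop (𝓝 v) := by
  have hC0 : 0 ≤ C := (norm_nonneg _).trans (hC 0)
  obtain ⟨v, hv⟩ := exists_tendsto_of_cauchySeq hC fun χ => by
    rw [Metric.cauchySeq_iff']
    intro ε hε
    -- `R` makes the tail of `χ` small in `L²`, uniformly in time; `T` is then taken for the ball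
    set κ := schwartzMult (besselSymbol n (-a)) χ with hκ
    have hκχ : schwartzMult (besselSymbol n a) κ = χ := schwartzMult_besselSymbol_neg a χ
    obtain ⟨R, hRε, hR⟩ := (((tendsto_iff_norm_sub_tendsto_zero.1
      (hF.tendsto_embL2_ballCutoff χ)).eventually_lt_const
        (show (0 : ℝ) < ε / (3 * (C + 1)) by positivity)).and (eventually_ge_atTop 1)).exists
    set χR := SchwartzMap.smulLeftCLM ℂ (ballCutoff n F R) χ with hχR
    have hlim : Tendsto (fun t => A R * r t * ‖embL2 n κ‖) atTop (𝓝 0) := by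
      simpa using (hr.const_mul (A R)).mul_const ‖embL2 n κ‖
    obtain ⟨T, hT, hT0⟩ := ((hlim.eventually_lt_const (show (0 : ℝ) < ε / 3 by positivity)).and
      (eventually_gt_atTop 0)).exists
    refine ⟨T, fun t ht => ?_⟩
    have hd : ∀ s, ‖toDistr (w s) χR - toDistr (w s) χ‖ < ε / 3 := fun s => by
      rw [← map_sub, toDistr_apply_eq_bilin ha0, map_sub (embL2 n)]
      calc _ ≤ ‖embL2 n χR - embL2 n χ‖ * ‖toL2 ha0 (w s)‖ := norm_bilin_le _ _
        _ ≤ ‖embL2 n χR - embL2 n χ‖ * (C + 1) := by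
          gcongr
          exact (norm_toL2_le ha0 _).trans ((hC s).trans (by linarith))
        _ < ε / (3 * (C + 1)) * (C + 1) := by gcongr
        _ = ε / 3 := by field_simp
    have h1 := hw R T t κ hR hT0 ht
    rw [hκχ] at h1
    have h2 := hd t
    have h3 := hd T
    have e : toDistr (w t) χ - toDistr (w T) χ = (toDistr (w t) χR - toDistr (w T) χR) -
        (toDistr (w t) χR - toDistr (w t) χ) + (toDistr (w T) χR - toDistr (w T) χ) := by ring
    rw [dist_eq_norm, e]
    have h4 := norm_add_le ((toDistr (w t) χR - toDistr (w T) χR) -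
        (toDistr (w t) χR - toDistr (w t) χ)) (toDistr (w T) χR - toDistr (w T) χ)
    have h5 := norm_sub_le (toDistr (w t) χR - toDistr (w T) χR)
        (toDistr (w t) χR - toDistr (w t) χ)
    linarith
  obtain ⟨T, CT, hT, hTC⟩ := exists_cutoffCLM n ha0 ha1 hF
  refine ⟨v, fun t => T (ρ t) (w t), hv, fun t ht => hT _ ht _, ?_⟩
  have h1 : Tendsto (fun t => T (ρ t) v) atTop (𝓝 v) := (tendsto_cutoff ha0 hF hT hTC v).comp hρ
  have h2 : Tendsto (fun t => T (ρ t) (w t - v)) atTop (𝓝 0) := by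
    refine squeeze_zero_norm' ?_ hρr
    filter_upwards [hρ.eventually_ge_atTop 1, eventually_gt_atTop 0] with t ht ht0
    refine norm_le_of_forall_schwartz (mul_nonneg (hA _) (hr0 t ht0)) fun κ => ?_
    rw [hT _ (by linarith), TemperedDistribution.smulLeftCLM_apply_apply, map_sub,
      _root_.sub_apply, norm_sub_rev]
    -- the later time is sent to infinity
    refine le_of_tendsto ((hv _).sub_const _).norm ?_
    filter_upwards [eventually_ge_atTop t] with t₂ ht₂
    exact hw (ρ t) t t₂ κ ht ht0 ht₂
  simpa using h2.add h1

end SobolevSpace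

end

theorem theorem1 (n : ℕ) (hn : 3 ≤ n) (a : ℝ) (ha0 : 0 ≤ a) (ha1 : a ≤ 1)
    (N : Eucl n → ℝ → (Eucl n → ℝ) → ℂ) (ψ : ℝ → SobolevSpace n a)
    (hψ : IsGlobalSolution ha0 N ψ)
    (hbdd : ∃ C : ℝ, ∀ t, ‖ψ t‖ ≤ C)
    (V : ℝ → SobolevSpace n a)
    (hV : MemLp V ∞ volume)
    (hVN : ∀ᵐ t, ∀ᵐ x,
      SobolevSpace.toL2 ha0 (V t) x = N x t (fun y => ‖SobolevSpace.toL2 ha0 (ψ t) y‖))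
    (F : ℝ → ℝ) (hF : IsSmoothCutoff F)
    (α : ℝ) (hα0 : 0 < α) (hα1 : α < 1 - 2 / (n : ℝ)) :
    ∃ Ω : SobolevSpace n a,
      SobolevSpace.TendstoStrongly
        (fun t => freeFlow n (-t) (innerCutoff n F α t (SobolevSpace.toDistr (ψ t)))) Ω ∧
      SobolevSpace.TendstoWeakly
        (fun t => freeFlow n (-t) (outerCutoff n F α t (SobolevSpace.toDistr (ψ t))))
        (0 : SobolevSpace n a) ∧
      SobolevSpace.TendstoStrongly
        (fun t => SobolevSpace.toDistr (ψ t) - freeFlow n t (SobolevSpace.toDistr Ω) -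
          outerCutoff n F α t (SobolevSpace.toDistr (ψ t)))
        (0 : SobolevSpace n a) := by
  obtain ⟨C, hC⟩ := hbdd
  have hCV : ∀ᵐ t, ‖V t‖ ≤ (eLpNorm V ⊤ volume).toReal := by
    filter_upwards [ae_le_eLpNormEssSup (f := V) (μ := volume)] with t ht
    rw [← toReal_enorm]
    exact ENNReal.toReal_mono hV.2.ne (by rwa [eLpNorm_exponent_top])
  obtain ⟨K, hK, hcook⟩ := hψ.exists_norm_sub_le ha1 hn hC hV.1 hCV hVN hF
  -- `w t = e^{itH₀} ψ(t)`, and `y t` is its part in the ball of radius `t^α`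
  choose w hw hwψ using fun t => SobolevSpace.exists_freeFlow (-t) (ψ t)
  have hn3 : (3 : ℝ) ≤ n := by exact_mod_cast hn
  obtain ⟨Ω, y, hΩ, hy, hyΩ⟩ := SobolevSpace.exists_tendsto_cutoff ha0 ha1 hF
    (w := w) (C := C) (A := fun R => K * |R| ^ (n / 2 : ℝ)) (r := fun t => t ^ (1 - n / 2 : ℝ))
    (ρ := fun t => t ^ α) (fun t => (hwψ t).trans (hC t)) (fun R => by positivity)
    (fun t ht => by positivity)
    (by
      rw [show (1 - n / 2 : ℝ) = -(n / 2 - 1) by ring]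
      exact tendsto_rpow_neg_atTop (by linarith))
    (fun R t₁ t₂ κ hR h1 h2 => by
      rw [hw, hw, abs_of_pos (by linarith)]
      exact hcook R t₁ t₂ κ hR h1 h2)
    (tendsto_rpow_atTop hα0)
    (by
      -- `t^{αn/2} t^{1-n/2} → 0` exactly because `α < 1 - 2/n`
      have h1 : 0 < n / 2 - 1 - α * (n / 2) := by
        have h2 : α * (n / 2) < (1 - 2 / n) * (n / 2) := by gcongr
        have h3 : (1 - 2 / n) * (n / 2) = (n / 2 - 1 : ℝ) := by field_simp
        linarith
      have h4 := (tendsto_rpow_neg_atTop h1).const_mul K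
      rw [mul_zero] at h4
      refine h4.congr' ?_
      filter_upwards [eventually_gt_atTop 0] with t ht
      rw [abs_of_pos (by positivity), ← Real.rpow_mul ht.le, mul_assoc, ← Real.rpow_add ht]
      congr 2
      ring)
  have hy' : ∀ t > 0, SobolevSpace.toDistr (y t) =
      freeFlow n (-t) (innerCutoff n F α t (SobolevSpace.toDistr (ψ t))) := fun t ht => by
    rw [hy t (by positivity), hw, innerCutoff_eq, freeFlow_neg_freeFlow]
  refine ⟨Ω, ⟨y, hy', hyΩ⟩, ⟨fun t => w t - y t, fun t ht => ?_, fun l => ?_⟩, ?_⟩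
  · beta_reduce
    rw [map_sub, hF.outerCutoff_eq α ht, map_sub, hw, hy' t ht]
  · refine SobolevSpace.tendsto_dual_of_tendsto_distr (C := C + (‖Ω‖ + 1)) ?_ (fun χ => ?_) l
    · filter_upwards [hyΩ.norm.eventually_lt_const (lt_add_one ‖Ω‖)] with t ht
      exact (norm_sub_le _ _).trans (add_le_add ((hwψ t).trans (hC t)) ht.le)
    · have h := (hΩ χ).sub (SobolevSpace.tendsto_toDistr hyΩ χ)
      rw [sub_self] at h
      simpa only [map_sub, _root_.sub_apply, map_zero, _root_.zero_apply] using h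
  · choose z hz hzn using fun t => SobolevSpace.exists_freeFlow t (y t - Ω)
    refine ⟨z, fun t ht => ?_, ?_⟩
    · have h1 : freeFlow n t (SobolevSpace.toDistr (y t)) =
          innerCutoff n F α t (SobolevSpace.toDistr (ψ t)) := by
        rw [hy' t ht, freeFlow_freeFlow_neg]
      beta_reduce
      rw [hz, map_sub, map_sub, hF.outerCutoff_eq α ht, h1]
      abel
    · exact squeeze_zero_norm hzn (tendsto_iff_norm_sub_tendsto_zero.1 hyΩ)
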